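/- **Setting.** Let $\Gamma$ be a metrized graph: a finite connected graph (multiple edges and self-loops allowed) with a finite non-empty vertex set, in which every edge $e_k$ has a length $L_k>0$ and end points $p_k,q_k$, and is parametrized by $[0,L_k]$ with $p_k$ and $q_k$ corresponding to $0$ and $L_k$. We view $\Gamma$ as an electric circuit in which the resistance of a segment is its length. For $x,y,z\in\Gamma$ let $j_z(x,y)$ be the voltage at $x$ when unit current enters at $y$ and exits at $z$, with voltage $0$ at $z$ (that is, $f=j_z(\cdot,y)$ is continuous, affine on every segment of an edge without $y$ or $z$ in its interior, $f(z)=0$, and at every point $a\in\Gamma$ minus the sum of the slopes of $f$ in the directions emanating from $a$ equals $\delta_y(a)-\delta_z(a)$). Let $r(x,y)=j_y(x,x)$ be the effective resistance. Let $\mu_{can}$ be the canonical measure, the signed Borel measure $\mu$ on $\Gamma$ with $\mu(\Gamma)=1$ for which $j_\mu(x,x)=\int_\Gamma j_z(x,x)\,d\mu(z)$ is constant in $x$; let the tau constant $\tau(\Gamma)$ be $\tfrac12 j_{\mu_{can}}(x,x)$; and let, with $\mu=\mu_{can}$, $$g_{\mu_{can}}(x,y)=\int_\Gamma j_z(x,y)\,d\mu(z)-\int_{\Gamma^3}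 j_z(x,y)\,d\mu(z)\,d\mu(x)\,d\mu(y).$$ For an edge $e$, let $\Gamma-e$ be $\Gamma$ with the interior of $e$ deleted; $e$ is a *bridge* if $\Gamma-e$ is disconnected. A point $y$ of $\Gamma-e_i$ is *on the side of* $p_i$ (of $q_i$) if it lies in the connected component of $\Gamma-e_i$ containing $p_i$ (containing $q_i$). A point $a$ is *between* $x$ and $y$ if every path in $\Gamma$ from $x$ to $y$ passes through $a$. **Theorem.** Let $e_i$ and $e_j$ be edges of $\Gamma$, and let $x$ belong to $e_i$ and $y$ to $e_j$; in the formulas $x\in[0,L_i]$ and $y\in[0,L_j]$ also denote the corresponding parameters. 1. If $e_i=e_j$ is a bridge, then $g_{\mu_{can}}(x,y)=\tau(\Gamma)-\frac12|x-y|$. 2. If $e_i$ and $e_j$ are distinct bridges, then at least one of the following four cases occurs, and $$g_{\mu_{can}}(x,y)=\begin{cases} \tau(\Gamma)-\frac12\big(x+y+r(p_i,p_j)\big), & \text{if $p_i$ and $p_j$ are between $x$ and $y$},\\ \tau(\Gamma)-\frac12\big(x+L_j-y+r(p_i,q_j)\big), & \text{if $p_i$ and $q_j$ are between $x$ and $y$},\\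 \tau(\Gamma)-\frac12\big(L_i-x+y+r(p_j,q_i)\big), & \text{if $p_j$ and $q_i$ are between $x$ and $y$},\\ \tau(\Gamma)-\frac12\big(L_i-x+L_j-y+r(q_i,q_j)\big), & \text{if $q_i$ and $q_j$ are between $x$ and $y$}. \end{cases}$$ 3. If $e_i$ is a bridge and $e_j$ is not, then $y$ is on the side of $p_i$ or on the side of $q_i$. If $y$ is on the side of $p_i$, then $$g_{\mu_{can}}(x,y)=\tau(\Gamma)+y^2\,\frac{L_j-r(p_j,q_j)}{2L_j^2}-y\,\frac{L_j-r(p_j,q_j)+r(p_i,q_j)-r(p_i,p_j)}{2L_j}-\frac12\big(x+r(p_i,p_j)\big).$$ If $y$ is on the side of $q_i$, then $$g_{\mu_{can}}(x,y)=\tau(\Gamma)+y^2\,\frac{L_j-r(p_j,q_j)}{2L_j^2}-y\,\frac{L_j-r(p_j,q_j)+r(q_i,q_j)-r(q_i,p_j)}{2L_j}-\frac12\big(L_i-x+r(q_i,p_j)\big).$$ If $e_j$ is a bridge and $e_i$ is not, the same holds with the roles of $(e_i,x)$ and $(e_j,y)$ exchanged. -/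

import Mathlib

/-- A connected metrized graph together with a vertex set `V`, an edge set `E`, and a
parametrization of each edge `e` by `[0, len e]`, the parameter `0` corresponding to `src e` and
`len e` to `tgt e`. Multiple edges and self-loops are allowed. Finiteness of `V` and `E` and
non-emptiness of `V` are imposed by type classes. -/
structure MetrizedGraph (V E : Type*) where
  src : E → V
  tgt : E → V
  len : E → ℝ
  len_pos : ∀ e, 0 < len e
  connected : ∀ u v : V, Relation.EqvGen (fun a b => ∃ e, src e = a ∧ tgt e = b) u v

namespace MetrizedGraph

open MeasureTheory Set

noncomputable section

variable {V E : Type*} (G : MetrizedGraph V E)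

/-- The disjoint union of the vertices and of the closed segments `[0, len e]`. -/
abbrev PrePoint : Type _ := V ⊕ (Σ e : E, Icc (0 : ℝ) (G.len e))

/-- The gluing: the two end points of the segment of `e` are glued to `src e` and `tgt e`. -/
inductive Glue : G.PrePoint → G.PrePoint → Prop
  | src (e : E) : Glue (Sum.inr ⟨e, ⟨0, le_rfl, (G.len_pos e).le⟩⟩) (Sum.inl (G.src e))
  | tgt (e : E) : Glue (Sum.inr ⟨e, ⟨G.len e, (G.len_pos e).le, le_rfl⟩⟩) (Sum.inl (G.tgt e))

/-- The underlying space `Γ` of the metrized graph. -/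
def Point : Type _ := Quot G.Glue

/-- The quotient topology, the vertices being discrete. -/
instance : TopologicalSpace G.Point :=
  letI : TopologicalSpace V := ⊥
  inferInstanceAs (TopologicalSpace (Quot G.Glue))

instance : MeasurableSpace G.Point := borel G.Point

instance : BorelSpace G.Point := ⟨rfl⟩

/-- A vertex, as a point of `Γ`. -/
def vertex (v : V) : G.Point := Quot.mk _ (Sum.inl v)

/-- The point of the edge `e` with parameter `t ∈ [0, len e]` (other reals `t` are clamped to this
interval). -/
def point (e : E) (t : ℝ) : G.Point :=
  Quot.mk _ (Sum.inr ⟨e, projIcc 0 (G.len e) (G.len_pos e).le t⟩)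

/-- The end point of `e` with parameter `0`. -/
def p (e : E) : G.Point := G.vertex (G.src e)

/-- The end point of `e` with parameter `len e`. -/
def q (e : E) : G.Point := G.vertex (G.tgt e)

/-! ### Bridges, sides of an edge, betweenness -/

/-- The interior of the edge `e`. -/
def edgeInterior (e : E) : Set G.Point := G.point e '' Ioo 0 (G.len e)

/-- `Γ - e`: only the interior of `e` is deleted. -/
def deleteEdge (e : E) : Set G.Point := (G.edgeInterior e)ᶜ

/-- `e` is a bridge if `Γ - e` is disconnected. -/
def IsBridge (e : E) : Prop := ¬ IsConnected (G.deleteEdge e)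

/-- `y` is on the side of the point `a` with respect to `e`: it lies in the connected component of
`Γ - e` that contains `a`. -/
def OnSide (e : E) (a y : G.Point) : Prop := y ∈ connectedComponentIn (G.deleteEdge e) a

/-- `a` is between `x` and `y`: every path from `x` to `y` passes through `a`. -/
def Between (a x y : G.Point) : Prop := ∀ γ : Path x y, a ∈ range γ

variable [Fintype E]

/-! ### Voltage and resistance -/

/-- The sum of the slopes of `f` at the point `a` in all directions emanating from `a`: an edge `e`
contributes a forward direction at each parameter `t ∈ [0, len e)` that represents `a`, and a
backward direction at each parameter `t ∈ (0, len e]` that represents `a`. -/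
def slopeSum (f : G.Point → ℝ) (a : G.Point) : ℝ :=
  ∑ e : E,
    ((∑ᶠ (t : ℝ) (_ : t ∈ Ico 0 (G.len e) ∧ G.point e t = a),
        derivWithin (fun s => f (G.point e s)) (Ioi t) t) -
      ∑ᶠ (t : ℝ) (_ : t ∈ Ioc 0 (G.len e) ∧ G.point e t = a),
        derivWithin (fun s => f (G.point e s)) (Iio t) t)

/-- `f` is the voltage on the circuit `Γ` (the resistance of a segment being its length) when unit
current enters at `y` and exits at `z`, with reference voltage `0` at `z`. The current leaving a
point in a given direction is minus the slope of `f` in that direction. -/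
structure IsVoltage (z y : G.Point) (f : G.Point → ℝ) : Prop where
  /-- Ohm's law: `f` is affine on every segment of an edge without a terminal in its interior.
  (This includes the continuity of `f`.) -/
  affine : ∀ (e : E) (a b : ℝ), 0 ≤ a → a ≤ b → b ≤ G.len e →
    (∀ t ∈ Ioo a b, G.point e t ≠ y ∧ G.point e t ≠ z) →
    ∃ m c : ℝ, ∀ t ∈ Icc a b, f (G.point e t) = m * t + c
  /-- Kirchhoff's law: `Δ f = δ_y - δ_z`. -/
  kirchhoff : ∀ a : G.Point,
    -G.slopeSum f a = indicator {y} (fun _ => (1 : ℝ)) a - indicator {z} (fun _ => (1 : ℝ)) a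
  ground : f z = 0

/-- The voltage function `j_z(x, y)`: the value at `x` of the voltage for unit current entering at
`y` and exiting at `z`, grounded at `z`. -/
def voltage (z x y : G.Point) : ℝ := Classical.epsilon (G.IsVoltage z y) x

/-- The effective resistance `r(x, y) = j_y(x, x)`. -/
def resistance (x y : G.Point) : ℝ := G.voltage y x x

/-! ### Canonical measure, tau constant, Arakelov-Green function -/

/-- `j_μ(x, y) = ∫ j_z(x, y) dμ(z)`. -/
def voltageIntegral (μ : SignedMeasure G.Point) (x y : G.Point) : ℝ :=
  ∫ᵛ z, G.voltage z x y ∂•μ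

/-- `μ` has total mass `1`, and `j_μ(x, x)` is constant on `Γ`. -/
def IsCanonicalMeasure (μ : SignedMeasure G.Point) : Prop :=
  μ univ = 1 ∧ ∃ c : ℝ, ∀ x, G.voltageIntegral μ x x = c

/-- The canonical measure `μ_can`. -/
def canonicalMeasure : SignedMeasure G.Point := Classical.epsilon G.IsCanonicalMeasure

/-- The tau constant: half of the constant `j_μ(x, x)` for `μ = μ_can`, read off at some vertex. -/
def tau [Nonempty V] : ℝ :=
  (1 / 2) * G.voltageIntegral G.canonicalMeasure
    (G.vertex (Classical.arbitrary V)) (G.vertex (Classical.arbitrary V))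

/-- The Arakelov-Green function `g_μ(x, y)` of a signed Borel measure `μ`. -/
def arakelovGreen (μ : SignedMeasure G.Point) (x y : G.Point) : ℝ :=
  (∫ᵛ z, G.voltage z x y ∂•μ) - ∫ᵛ y', (∫ᵛ x', (∫ᵛ z, G.voltage z x' y' ∂•μ) ∂•μ) ∂•μ

/-- The Arakelov-Green function `g_{μ_can}(x, y)`. -/
def greenCan (x y : G.Point) : ℝ := G.arakelovGreen G.canonicalMeasure x y

end

end MetrizedGraph

namespace MetrizedGraph

open MeasureTheory Set

noncomputable section

variable {V E : Type*} (G : MetrizedGraph V E)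

/-! ### Points of a metrized graph -/

/-! Everything reduces to the identity g(x,y) = τ − r(x,y)/2 (`greenCan_eq`), after which only
resistances across bridges remain.

Voltages, resistances and integrals are all computed from one symmetric kernel k. It distributes a
point linearly to the end points of its edge, pairs the resulting vertex weights through the inverse
of (Laplacian + all-ones matrix), and adds the Dirichlet Green function of each edge. Then k(x,y) −
k(x,z) − k(z,y) + k(z,z) satisfies the axioms of j_z(x,y), and `IsVoltage.unique` shows that nothing
else does. Hence r(x,y) = k(x,x) − 2k(x,y) + k(y,y).

A measure with atoms at the vertices and constant densities on the edges is shown to be canonical,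
so the chosen `canonicalMeasure` has the defining properties; its uniqueness is not needed.
Integrating the formula for j_z gives j_μ(x,y) = k(x,y) − A(x) − A(y) + B. Comparison with the
constant diagonal 2τ yields j_μ(x,y) = 2τ − r(x,y)/2. Moreover ∫ r(x,y) dμ(x) = j_μ(y,y) = 2τ, so
the normalizing triple integral is τ.

A unit current between the ends of a bridge stays in the bridge. Its potential is therefore, up to a
constant, the length times the function that is 1 on one side, 0 on the other and affine in between
(`IsBridge.exists_kernel_sub`). By symmetry of k, resistance from a point of a bridge is the
distance to the relevant end plus the resistance from that end. On an arbitrary edge the resistance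
to a vertex is quadratic, which gives the formula of part 3.

The hypotheses on paths and components are turned into values of the cut function: it is locally
constant off the bridge, and betweenness is settled by explicit paths in one direction and by the
intermediate value theorem in the other. -/

lemma point_zero (e : E) : G.point e 0 = G.p e := by
  have h : projIcc 0 (G.len e) (G.len_pos e).le 0 = ⟨0, le_rfl, (G.len_pos e).le⟩ :=
    projIcc_left _
  rw [point, h]
  exact Quot.sound (Glue.src e)

lemma point_len (e : E) : G.point e (G.len e) = G.q e := by
  have h : projIcc 0 (G.len e) (G.len_pos e).le (G.len e) = ⟨G.len e, (G.len_pos e).le, le_rfl⟩ :=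
    projIcc_right _
  rw [point, h]
  exact Quot.sound (Glue.tgt e)

lemma exists_vertex_or_point (a : G.Point) :
    (∃ v, a = G.vertex v) ∨ ∃ e, ∃ t ∈ Ioo 0 (G.len e), a = G.point e t := by
  induction a using Quot.ind with
  | mk a =>
    rcases a with v | ⟨e, t, ht⟩
    · exact Or.inl ⟨v, rfl⟩
    · have h : (Quot.mk _ (Sum.inr ⟨e, t, ht⟩) : G.Point) = G.point e t := by
        rw [point, projIcc_of_mem _ ht]
      change (∃ v, (Quot.mk _ (Sum.inr ⟨e, t, ht⟩) : G.Point) = G.vertex v) ∨ _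
      rcases eq_or_lt_of_le ht.1 with h0 | h0
      · refine Or.inl ⟨G.src e, ?_⟩
        rw [h, ← h0, point_zero]; rfl
      rcases eq_or_lt_of_le ht.2 with h1 | h1
      · refine Or.inl ⟨G.tgt e, ?_⟩
        rw [h, h1, point_len]; rfl
      · exact Or.inr ⟨e, t, ⟨h0, h1⟩, h⟩

lemma continuous_point (e : E) : Continuous (G.point e) := by
  let _ : TopologicalSpace V := ⊥
  have h : Continuous (fun t : ℝ =>
      (Sum.inr ⟨e, projIcc 0 (G.len e) (G.len_pos e).le t⟩ : G.PrePoint)) :=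
    continuous_inr.comp (continuous_sigmaMk.comp continuous_projIcc)
  exact continuous_quot_mk.comp h

/-- A function on `Γ` is continuous if it is continuous along every edge. -/
lemma continuous_of_point {X : Type*} [TopologicalSpace X] {f : G.Point → X}
    (hf : ∀ e, ContinuousOn (fun t => f (G.point e t)) (Icc 0 (G.len e))) : Continuous f := by
  let _ : TopologicalSpace V := ⊥
  have : DiscreteTopology V := ⟨rfl⟩
  refine continuous_coinduced_dom.2 ?_
  refine continuous_sum_dom.2 ⟨continuous_of_discreteTopology, continuous_sigma fun e => ?_⟩
  have h := continuousOn_iff_continuous_domRestrict.1 (hf e)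
  refine h.congr fun t => ?_
  change f (G.point e t) = f (Quot.mk _ (Sum.inr ⟨e, t⟩))
  rw [point, projIcc_val]

instance [Finite V] [Finite E] : CompactSpace G.Point := by
  let _ : TopologicalSpace V := ⊥
  have : DiscreteTopology V := ⟨rfl⟩
  exact inferInstanceAs (CompactSpace (Quot G.Glue))

/-- The barycentric weights of a point: the unit mass at a point of an edge, distributed linearly to
the end points of the edge. -/
def weight [DecidableEq V] : G.Point → V → ℝ :=
  Quot.lift (Sum.elim (fun v => Pi.single v 1) fun t =>
    (1 - (t.2 : ℝ) / G.len t.1) • Pi.single (G.src t.1) 1 +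
      ((t.2 : ℝ) / G.len t.1) • Pi.single (G.tgt t.1) 1) <| by
    rintro _ _ (e | e)
    · simp
    · have := (G.len_pos e).ne'
      simp [this]

/-- The parameter of a point of the interior of `e`, and `0` outside of the interior of `e`. -/
def coord [DecidableEq E] (e : E) : G.Point → ℝ :=
  Quot.lift (Sum.elim (fun _ => 0) fun t =>
    if t.1 = e ∧ (t.2 : ℝ) < G.len t.1 then (t.2 : ℝ) else 0) <| by
    rintro _ _ (e' | e') <;> simp

section weight

variable [DecidableEq V]

lemma weight_vertex (v : V) : G.weight (G.vertex v) = Pi.single v 1 := rfl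

lemma weight_point {e : E} {t : ℝ} (ht : t ∈ Icc 0 (G.len e)) :
    G.weight (G.point e t) =
      (1 - t / G.len e) • Pi.single (G.src e) 1 + (t / G.len e) • Pi.single (G.tgt e) 1 := by
  rw [point, projIcc_of_mem _ ht]; rfl

lemma vertex_injective : Function.Injective G.vertex := by
  intro v w h
  have := congrArg (fun a => G.weight a v) h
  by_contra hne
  simp [weight_vertex, hne] at this

end weight

section coord

variable [DecidableEq E]

lemma coord_vertex (e : E) (v : V) : G.coord e (G.vertex v) = 0 := rfl

lemma coord_point_self {e : E} {t : ℝ} (ht : t ∈ Ico 0 (G.len e)) :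
    G.coord e (G.point e t) = t := by
  rw [point, projIcc_of_mem _ ⟨ht.1, ht.2.le⟩]
  simp [coord, ht.2]

lemma coord_point_of_ne {e e' : E} (h : e' ≠ e) (t : ℝ) : G.coord e (G.point e' t) = 0 := by
  simp [coord, point, h]

lemma coord_mem_Ico (e : E) (a : G.Point) : G.coord e a ∈ Ico 0 (G.len e) := by
  have := G.len_pos e
  rcases G.exists_vertex_or_point a with ⟨v, rfl⟩ | ⟨e', t, ht, rfl⟩
  · simp [coord_vertex, this]
  · by_cases h : e' = e
    · subst h
      rw [coord_point_self G ⟨ht.1.le, ht.2⟩]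
      exact ⟨ht.1.le, ht.2⟩
    · simp [coord_point_of_ne G h, this]

/-- The default value 0 of `coord` lies outside the open interval, so a positive coordinate
determines both the edge and the point. -/
lemma point_eq_iff_coord {e : E} {t : ℝ} (ht : t ∈ Ioo 0 (G.len e)) (a : G.Point) :
    G.point e t = a ↔ G.coord e a = t := by
  constructor
  · rintro rfl
    exact G.coord_point_self ⟨ht.1.le, ht.2⟩
  · intro h
    rcases G.exists_vertex_or_point a with ⟨v, rfl⟩ | ⟨e', t', ht', rfl⟩
    · rw [coord_vertex] at h
      exact absurd h ht.1.ne
    · by_cases he : e' = e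
      · subst he
        rw [coord_point_self G ⟨ht'.1.le, ht'.2⟩] at h
        rw [h]
      · rw [coord_point_of_ne G he] at h
        exact absurd h ht.1.ne

end coord

lemma point_ne_vertex {e : E} {t : ℝ} (ht : t ∈ Ioo 0 (G.len e)) (v : V) :
    G.point e t ≠ G.vertex v := by
  classical
  rw [Ne, point_eq_iff_coord G ht, coord_vertex]
  exact ht.1.ne

lemma edge_eq_of_point_eq {e e' : E} {t t' : ℝ} (ht : t ∈ Ioo 0 (G.len e))
    (h : G.point e' t' = G.point e t) : e' = e := by
  classical
  by_contra hne
  have := (G.point_eq_iff_coord ht _).1 h.symm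
  rw [coord_point_of_ne G hne] at this
  exact ht.1.ne this

lemma p_eq_q_iff (e : E) : G.p e = G.q e ↔ G.src e = G.tgt e := by
  classical
  exact G.vertex_injective.eq_iff

end

end MetrizedGraph

namespace MetrizedGraph

open MeasureTheory Set

set_option linter.unusedSectionVars false

noncomputable section

variable {V E : Type*} (G : MetrizedGraph V E)

/-! ### The vertex Laplacian -/

/-- The signed incidence vector of an edge. -/
def incidence [DecidableEq V] (e : E) : V → ℝ := Pi.single (G.src e) 1 - Pi.single (G.tgt e) 1

/-- The vertex Laplacian, the conductance of an edge being the inverse of its length. -/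
def laplacian [DecidableEq V] [Fintype E] (u : V → ℝ) (v : V) : ℝ :=
  ∑ e, (u (G.src e) - u (G.tgt e)) / G.len e * G.incidence e v

/-- The matrix of the vertex Laplacian plus the all-ones matrix. -/
def laplacianAddOnes [DecidableEq V] [Fintype E] : Matrix V V ℝ :=
  Matrix.of fun v w => ∑ e, G.incidence e w / G.len e * G.incidence e v + 1

/-- The target is arbitrary because this serves both for real functions and for predicates on
vertices. -/
lemma eq_of_forall_edge {α : Type*} {u : V → α} (h : ∀ e, u (G.src e) = u (G.tgt e)) (v w : V) :
    u v = u w := by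
  induction G.connected v w with
  | rel a b hab => obtain ⟨e, rfl, rfl⟩ := hab; exact h e
  | refl => rfl
  | symm _ _ _ ih => exact ih.symm
  | trans _ _ _ _ _ ih₁ ih₂ => exact ih₁.trans ih₂

section laplacian

variable [DecidableEq V] [Fintype V] [Fintype E]

open Matrix

lemma sum_mul_incidence (u : V → ℝ) (e : E) :
    ∑ v, u v * G.incidence e v = u (G.src e) - u (G.tgt e) := by
  simp [incidence, mul_sub, Finset.sum_sub_distrib, Pi.single_apply]

/-- Summation by parts. The case `w = u` is the Dirichlet energy, the case `w = 1` conservation of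
current. -/
lemma sum_mul_laplacian (u w : V → ℝ) :
    ∑ v, w v * G.laplacian u v =
      ∑ e, (u (G.src e) - u (G.tgt e)) / G.len e * (w (G.src e) - w (G.tgt e)) := by
  simp only [laplacian, Finset.mul_sum]
  rw [Finset.sum_comm]
  refine Finset.sum_congr rfl fun e _ => ?_
  rw [← sum_mul_incidence G w, Finset.mul_sum]
  exact Finset.sum_congr rfl fun v _ => by ring

lemma sum_laplacian (u : V → ℝ) : ∑ v, G.laplacian u v = 0 := by
  simpa using G.sum_mul_laplacian u (fun _ => 1)

/-- Harmonic functions on the vertices are constant. -/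
lemma eq_of_laplacian_eq_zero {u : V → ℝ} (h : ∀ v, G.laplacian u v = 0) (v w : V) :
    u v = u w := by
  have h0 := G.sum_mul_laplacian u u
  simp only [h, mul_zero, Finset.sum_const_zero] at h0
  -- The energy vanishes and its summands are nonnegative, so there is no voltage drop along any
  -- edge.
  have hpos : ∀ e ∈ Finset.univ,
      0 ≤ (u (G.src e) - u (G.tgt e)) / G.len e * (u (G.src e) - u (G.tgt e)) := fun e _ => by
    have := G.len_pos e
    rw [div_mul_eq_mul_div]
    exact div_nonneg (mul_self_nonneg _) this.le
  have h1 := (Finset.sum_eq_zero_iff_of_nonneg hpos).1 h0.symm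
  refine G.eq_of_forall_edge (fun e => ?_) v w
  have h2 := h1 e (Finset.mem_univ e)
  have := (G.len_pos e).ne'
  simp only [mul_eq_zero, div_eq_zero_iff, this, or_false, or_self] at h2
  linarith

lemma laplacianAddOnes_mulVec (u : V → ℝ) (v : V) :
    (G.laplacianAddOnes *ᵥ u) v = G.laplacian u v + ∑ w, u w := by
  simp only [mulVec, dotProduct, laplacianAddOnes, of_apply, laplacian, add_mul, one_mul,
    Finset.sum_add_distrib, Finset.sum_mul]
  congr 1
  rw [Finset.sum_comm]
  refine Finset.sum_congr rfl fun e _ => ?_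
  rw [← sum_mul_incidence, Finset.sum_div, Finset.sum_mul]
  exact Finset.sum_congr rfl fun v _ => by ring

lemma transpose_laplacianAddOnes : G.laplacianAddOnesᵀ = G.laplacianAddOnes := by
  ext v w
  simp only [transpose_apply, laplacianAddOnes, of_apply]
  congr 1
  exact Finset.sum_congr rfl fun e _ => by ring

lemma sum_laplacianAddOnes_mulVec (u : V → ℝ) :
    ∑ v, (G.laplacianAddOnes *ᵥ u) v = Fintype.card V * ∑ w, u w := by
  simp [laplacianAddOnes_mulVec, Finset.sum_add_distrib, sum_laplacian]

variable [Nonempty V]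

/-- A null vector has total 0 because the Laplacian has zero column sums; it is then harmonic, hence
constant, hence 0. -/
lemma isUnit_laplacianAddOnes : IsUnit G.laplacianAddOnes := by
  rw [← mulVec_injective_iff_isUnit]
  refine (injective_iff_map_eq_zero (mulVecLin G.laplacianAddOnes)).2 fun u hu => ?_
  have hu : G.laplacianAddOnes *ᵥ u = 0 := hu
  have hs := G.sum_laplacianAddOnes_mulVec u
  simp only [hu, Pi.zero_apply, Finset.sum_const_zero] at hs
  have hs : ∑ w, u w = 0 := by
    rcases mul_eq_zero.1 hs.symm with h | h
    · simp at h
    · exact h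
  have hl : ∀ v, G.laplacian u v = 0 := fun v => by
    have := G.laplacianAddOnes_mulVec u v
    rw [hu, hs] at this
    simpa using this.symm
  have hc := G.eq_of_laplacian_eq_zero hl
  funext v
  have : ∑ w, u w = Fintype.card V * u v := by
    rw [Finset.sum_congr rfl fun w _ => hc w v]; simp
  rw [hs] at this
  rcases mul_eq_zero.1 this.symm with h | h
  · simp at h
  · exact h

/-- The symmetric inverse of the Laplacian, normalized by the all-ones matrix. -/
def potential (b : V → ℝ) : V → ℝ := G.laplacianAddOnes⁻¹ *ᵥ b

lemma laplacianAddOnes_mulVec_potential (b : V → ℝ) :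
    G.laplacianAddOnes *ᵥ G.potential b = b := by
  rw [potential, mulVec_mulVec, mul_nonsing_inv _ ((isUnit_iff_isUnit_det _).1
    G.isUnit_laplacianAddOnes), one_mulVec]

lemma potential_laplacianAddOnes_mulVec (u : V → ℝ) :
    G.potential (G.laplacianAddOnes *ᵥ u) = u := by
  rw [potential, mulVec_mulVec, nonsing_inv_mul _ ((isUnit_iff_isUnit_det _).1
    G.isUnit_laplacianAddOnes), one_mulVec]

lemma dotProduct_potential_comm (b c : V → ℝ) :
    b ⬝ᵥ G.potential c = c ⬝ᵥ G.potential b := by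
  rw [potential, potential, dotProduct_mulVec, ← mulVec_transpose, transpose_nonsing_inv,
    transpose_laplacianAddOnes, dotProduct_comm]

lemma potential_sub (b c : V → ℝ) : G.potential (b - c) = G.potential b - G.potential c :=
  mulVec_sub _ _ _

/-- A source of total 0 has a potential of total 0, on which the all-ones matrix does not act. -/
lemma laplacian_potential {b : V → ℝ} (hb : ∑ v, b v = 0) (v : V) :
    G.laplacian (G.potential b) v = b v := by
  have hs := G.sum_laplacianAddOnes_mulVec (G.potential b)
  rw [laplacianAddOnes_mulVec_potential, hb] at hs
  have h := G.laplacianAddOnes_mulVec (G.potential b) v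
  rw [laplacianAddOnes_mulVec_potential] at h
  rcases mul_eq_zero.1 hs.symm with h' | h'
  · simp at h'
  · rw [h, h', add_zero]

end laplacian

/-! ### The kernel -/

/-- The Green function of the segment `[0, len e]` with Dirichlet boundary conditions. -/
def hat (e : E) (s t : ℝ) : ℝ := min s t - s * t / G.len e

lemma hat_comm (e : E) (s t : ℝ) : G.hat e s t = G.hat e t s := by
  simp [hat, min_comm, mul_comm]

lemma hat_zero_left (e : E) {t : ℝ} (ht : 0 ≤ t) : G.hat e 0 t = 0 := by simp [hat, ht]

lemma hat_len_left (e : E) {t : ℝ} (ht : t ≤ G.len e) : G.hat e (G.len e) t = 0 := by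
  simp [hat, ht, (G.len_pos e).ne']

lemma hat_self (e : E) (t : ℝ) : G.hat e t t = t - t * t / G.len e := by simp [hat]

variable [DecidableEq V] [DecidableEq E] [Fintype V] [Fintype E]

open Matrix in
/-- A symmetric kernel on `Γ` from which all voltage functions are computed. -/
def kernel (x y : G.Point) : ℝ :=
  G.weight x ⬝ᵥ G.potential (G.weight y) + ∑ e, G.hat e (G.coord e x) (G.coord e y)

lemma sum_weight (x : G.Point) : ∑ v, G.weight x v = 1 := by
  rcases G.exists_vertex_or_point x with ⟨v, rfl⟩ | ⟨e, t, ht, rfl⟩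
  · simp [weight_vertex]
  · rw [weight_point G ⟨ht.1.le, ht.2.le⟩]
    simp [Finset.sum_add_distrib, ← Finset.mul_sum]

/-- At the far end of `e` the coordinate is 0 and not `len e`; this does no harm because `hat`
vanishes at both parameters. -/
lemma sum_hat_point {e : E} {t : ℝ} (ht : t ∈ Icc 0 (G.len e)) (y : G.Point) :
    ∑ e', G.hat e' (G.coord e' (G.point e t)) (G.coord e' y) = G.hat e t (G.coord e y) := by
  rcases eq_or_lt_of_le ht.2 with h | h
  · rw [h, point_len, hat_len_left _ _ (G.coord_mem_Ico e y).2.le]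
    refine Finset.sum_eq_zero fun e' _ => ?_
    rw [q, coord_vertex, hat_zero_left _ _ (G.coord_mem_Ico e' y).1]
  · rw [Finset.sum_eq_single e, coord_point_self G ⟨ht.1, h⟩]
    · intro e' _ he
      rw [coord_point_of_ne G he.symm, hat_zero_left _ _ (G.coord_mem_Ico e' y).1]
    · simp

variable [Nonempty V]

lemma kernel_comm (x y : G.Point) : G.kernel x y = G.kernel y x := by
  rw [kernel, kernel, dotProduct_potential_comm]
  simp only [hat_comm]

lemma kernel_vertex (v : V) (y : G.Point) :
    G.kernel (G.vertex v) y = G.potential (G.weight y) v := by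
  rw [kernel, weight_vertex, single_one_dotProduct, Finset.sum_eq_zero, add_zero]
  intro e _
  rw [coord_vertex, hat_zero_left _ _ (G.coord_mem_Ico e y).1]

/-- Both the weights and the potential pairing are linear, so only `hat` deviates from linear
interpolation along an edge. -/
lemma kernel_point {e : E} {t : ℝ} (ht : t ∈ Icc 0 (G.len e)) (y : G.Point) :
    G.kernel (G.point e t) y = (1 - t / G.len e) * G.kernel (G.p e) y +
      t / G.len e * G.kernel (G.q e) y + G.hat e t (G.coord e y) := by
  rw [p, q, kernel_vertex, kernel_vertex, kernel, sum_hat_point G ht, weight_point G ht]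
  simp [add_dotProduct]

lemma kernel_point_self {e : E} {t : ℝ} (ht : t ∈ Icc 0 (G.len e)) :
    G.kernel (G.point e t) (G.point e t) =
      (1 - t / G.len e) ^ 2 * G.kernel (G.p e) (G.p e) +
      2 * (1 - t / G.len e) * (t / G.len e) * G.kernel (G.p e) (G.q e) +
      (t / G.len e) ^ 2 * G.kernel (G.q e) (G.q e) + (t - t ^ 2 / G.len e) := by
  have hc : G.hat e t (G.coord e (G.point e t)) = t - t ^ 2 / G.len e := by
    rcases eq_or_lt_of_le ht.2 with h | h
    · have := (G.len_pos e).ne'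
      rw [h, point_len, q, coord_vertex, hat_comm, hat_zero_left _ _ (G.len_pos e).le]
      field_simp; ring
    · rw [coord_point_self G ⟨ht.1, h⟩, hat_self, sq]
  have h0 : G.coord e (G.p e) = 0 := rfl
  have h1 : G.coord e (G.q e) = 0 := rfl
  have h2 : G.hat e t 0 = 0 := by rw [hat_comm, hat_zero_left _ _ ht.1]
  rw [kernel_point G ht, hc, kernel_comm G (G.p e) (G.point e t),
    kernel_comm G (G.q e) (G.point e t), kernel_point G ht, kernel_point G ht, h0, h1, h2,
    kernel_comm G (G.q e) (G.p e)]
  ring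

lemma continuous_kernel (y : G.Point) : Continuous fun x => G.kernel x y := by
  refine G.continuous_of_point fun e => ?_
  refine ContinuousOn.congr (f := fun t => (1 - t / G.len e) * G.kernel (G.p e) y +
      t / G.len e * G.kernel (G.q e) y + G.hat e t (G.coord e y)) ?_ fun t ht => kernel_point G ht y
  unfold hat
  fun_prop

lemma continuous_kernel_self : Continuous fun x => G.kernel x x := by
  refine G.continuous_of_point fun e => ?_
  refine ContinuousOn.congr ?_ fun t ht => kernel_point_self G ht
  fun_prop

end

end MetrizedGraph

section OneSided

open Set

/-! ### One-sided derivatives of piecewise affine functions -/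

lemma hasDerivWithinAt_Ioi_of_affine {φ : ℝ → ℝ} {t b m c : ℝ} (h : t < b)
    (H : ∀ s ∈ Icc t b, φ s = m * s + c) : HasDerivWithinAt φ m (Ioi t) t := by
  have h1 : HasDerivWithinAt (fun s => m * s + c) m (Ioi t) t := by
    simpa using (((hasDerivAt_id t).const_mul m).add_const c).hasDerivWithinAt (s := Ioi t)
  refine h1.congr_of_eventuallyEq ?_ (H t ⟨le_rfl, h.le⟩)
  filter_upwards [Ioc_mem_nhdsGT h] with s hs using H s ⟨hs.1.le, hs.2⟩

lemma hasDerivWithinAt_Iio_of_affine {φ : ℝ → ℝ} {a t m c : ℝ} (h : a < t)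
    (H : ∀ s ∈ Icc a t, φ s = m * s + c) : HasDerivWithinAt φ m (Iio t) t := by
  have h1 : HasDerivWithinAt (fun s => m * s + c) m (Iio t) t := by
    simpa using (((hasDerivAt_id t).const_mul m).add_const c).hasDerivWithinAt (s := Iio t)
  refine h1.congr_of_eventuallyEq ?_ (H t ⟨h.le, le_rfl⟩)
  filter_upwards [Ico_mem_nhdsLT h] with s hs using H s ⟨hs.1, hs.2.le⟩

/-- Two affine pieces without a kink glue. The slopes are compared only when both pieces are
nondegenerate, so that break points may coincide with each other or with an end point. -/
lemma exists_affine_of_derivWithin_eq {φ : ℝ → ℝ} {a b c : ℝ} (hab : a ≤ b) (hbc : b ≤ c)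
    (h₁ : ∃ m k : ℝ, ∀ s ∈ Icc a b, φ s = m * s + k)
    (h₂ : ∃ m k : ℝ, ∀ s ∈ Icc b c, φ s = m * s + k)
    (h : a < b → b < c → derivWithin φ (Ioi b) b = derivWithin φ (Iio b) b) :
    ∃ m k : ℝ, ∀ s ∈ Icc a c, φ s = m * s + k := by
  rcases hab.eq_or_lt with rfl | hab
  · exact h₂
  rcases hbc.eq_or_lt with rfl | hbc
  · exact h₁
  obtain ⟨m₁, k₁, h₁⟩ := h₁
  obtain ⟨m₂, k₂, h₂⟩ := h₂
  have h := h hab hbc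
  rw [(hasDerivWithinAt_Ioi_of_affine hbc h₂).derivWithin (uniqueDiffWithinAt_Ioi b),
    (hasDerivWithinAt_Iio_of_affine hab h₁).derivWithin (uniqueDiffWithinAt_Iio b)] at h
  subst h
  have hk : k₁ = k₂ := by
    have := h₁ b ⟨hab.le, le_rfl⟩
    rw [h₂ b ⟨le_rfl, hbc.le⟩] at this
    linarith
  subst hk
  refine ⟨m₂, k₁, fun s hs => ?_⟩
  rcases le_total s b with h | h
  · exact h₁ s ⟨hs.1, h⟩
  · exact h₂ s ⟨h, hs.2⟩

/-- Strict inequality here against `≤` on the left side is exactly the unit drop of slope at `c`,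
the source of the point masses in Kirchhoff's law. -/
lemma hasDerivWithinAt_min_Ioi (c t : ℝ) :
    HasDerivWithinAt (fun s => min s c) (if t < c then 1 else 0) (Ioi t) t := by
  split_ifs with h
  · exact hasDerivWithinAt_Ioi_of_affine (c := 0) h fun s hs => by simp [hs.2]
  · exact hasDerivWithinAt_Ioi_of_affine (c := c) (lt_add_one t) fun s hs => by
      simp [(not_lt.1 h).trans hs.1]

lemma hasDerivWithinAt_min_Iio (c t : ℝ) :
    HasDerivWithinAt (fun s => min s c) (if t ≤ c then 1 else 0) (Iio t) t := by
  split_ifs with h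
  · exact hasDerivWithinAt_Iio_of_affine (c := 0) (sub_one_lt t) fun s hs => by
      simp [hs.2.trans h]
  · exact hasDerivWithinAt_Iio_of_affine (c := c) (not_le.1 h) fun s hs => by simp [hs.1]

end OneSided

namespace MetrizedGraph

open MeasureTheory Set

set_option linter.unusedSectionVars false

noncomputable section

variable {V E : Type*} (G : MetrizedGraph V E)

/-! ### The sum of the slopes at a point -/

section slope

variable [Fintype E]

/-- The slope of `f` on `e` at the parameter `t`, in the forward direction. -/
def slopeRight (f : G.Point → ℝ) (e : E) (t : ℝ) : ℝ :=
  derivWithin (fun s => f (G.point e s)) (Ioi t) t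

/-- The derivative of `f` on `e` from the left at the parameter `t`. -/
def slopeLeft (f : G.Point → ℝ) (e : E) (t : ℝ) : ℝ :=
  derivWithin (fun s => f (G.point e s)) (Iio t) t

/-- With half-open parameter intervals a self-loop contributes one forward and one backward
direction at its vertex. -/
lemma point_eq_vertex_iff_src {e : E} {t : ℝ} (v : V) :
    t ∈ Ico 0 (G.len e) ∧ G.point e t = G.vertex v ↔ t = 0 ∧ G.src e = v := by
  classical
  constructor
  · rintro ⟨ht, h⟩
    rcases ht.1.eq_or_lt with h0 | h0
    · subst h0
      rw [point_zero] at h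
      exact ⟨rfl, G.vertex_injective h⟩
    · exact absurd h (G.point_ne_vertex ⟨h0, ht.2⟩ v)
  · rintro ⟨rfl, rfl⟩
    exact ⟨⟨le_rfl, G.len_pos e⟩, G.point_zero e⟩

lemma point_eq_vertex_iff_tgt {e : E} {t : ℝ} (v : V) :
    t ∈ Ioc 0 (G.len e) ∧ G.point e t = G.vertex v ↔ t = G.len e ∧ G.tgt e = v := by
  classical
  constructor
  · rintro ⟨ht, h⟩
    rcases ht.2.eq_or_lt with h0 | h0
    · subst h0
      rw [point_len] at h
      exact ⟨rfl, G.vertex_injective h⟩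
    · exact absurd h (G.point_ne_vertex ⟨ht.1, h0⟩ v)
  · rintro ⟨rfl, rfl⟩
    exact ⟨⟨G.len_pos e, le_rfl⟩, G.point_len e⟩

lemma slopeSum_vertex [DecidableEq V] (f : G.Point → ℝ) (v : V) :
    G.slopeSum f (G.vertex v) =
      ∑ e, ((if G.src e = v then G.slopeRight f e 0 else 0) -
        if G.tgt e = v then G.slopeLeft f e (G.len e) else 0) := by
  refine Finset.sum_congr rfl fun e _ => ?_
  simp only [point_eq_vertex_iff_src, point_eq_vertex_iff_tgt]
  congr 1
  · by_cases h : G.src e = v <;> simp [h, slopeRight]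
  · by_cases h : G.tgt e = v <;> simp [h, slopeLeft]

lemma slopeSum_point (f : G.Point → ℝ) {e : E} {t : ℝ} (ht : t ∈ Ioo 0 (G.len e)) :
    G.slopeSum f (G.point e t) = G.slopeRight f e t - G.slopeLeft f e t := by
  classical
  have key : ∀ (e' : E) (t' : ℝ), 0 ≤ t' → t' ≤ G.len e' →
      (G.point e' t' = G.point e t ↔ e' = e ∧ t' = t) := by
    intro e' t' h0 h1
    refine ⟨fun h => ?_, by rintro ⟨rfl, rfl⟩; rfl⟩
    have he := G.edge_eq_of_point_eq ht h
    subst he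
    refine ⟨rfl, ?_⟩
    rcases h0.eq_or_lt with h0 | h0
    · rw [← h0, point_zero] at h
      exact absurd h.symm (G.point_ne_vertex ht _)
    rcases h1.eq_or_lt with h1 | h1
    · rw [h1, point_len] at h
      exact absurd h.symm (G.point_ne_vertex ht _)
    have := (G.point_eq_iff_coord ht _).1 h.symm
    rwa [G.coord_point_self ⟨h0.le, h1⟩] at this
  rw [slopeSum, Finset.sum_eq_single e]
  · have h₁ : ∀ t', (t' ∈ Ico 0 (G.len e) ∧ G.point e t' = G.point e t) ↔ t' = t := fun t' => by
      refine ⟨fun h => ((key e t' h.1.1 h.1.2.le).1 h.2).2, ?_⟩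
      rintro rfl; exact ⟨⟨ht.1.le, ht.2⟩, rfl⟩
    have h₂ : ∀ t', (t' ∈ Ioc 0 (G.len e) ∧ G.point e t' = G.point e t) ↔ t' = t := fun t' => by
      refine ⟨fun h => ((key e t' h.1.1.le h.1.2).1 h.2).2, ?_⟩
      rintro rfl; exact ⟨⟨ht.1, ht.2.le⟩, rfl⟩
    simp only [h₁, h₂, finsum_cond_eq_left, slopeRight, slopeLeft]
  · intro e' _ he
    have h : ∀ t', G.point e' t' ≠ G.point e t := fun t' h => he (G.edge_eq_of_point_eq ht h)
    simp [h]
  · simp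

end slope

/-! ### Voltage functions: existence -/

section voltage

variable [DecidableEq V] [DecidableEq E] [Fintype V] [Fintype E] [Nonempty V]

/-- The voltage function, computed from the kernel. -/
def kernelVoltage (z x y : G.Point) : ℝ :=
  G.kernel x y - G.kernel x z - G.kernel z y + G.kernel z z

/-- The two `min` terms isolate the only possible kinks, at the terminals; the rest is affine in
`t`. -/
lemma kernelVoltage_point {e : E} {t : ℝ} (ht : t ∈ Icc 0 (G.len e)) (z y : G.Point) :
    G.kernelVoltage z (G.point e t) y =
      t * ((G.kernelVoltage z (G.q e) y - G.kernelVoltage z (G.p e) y) / G.len e -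
        G.coord e y / G.len e + G.coord e z / G.len e) +
      (min t (G.coord e y) - min t (G.coord e z)) + G.kernelVoltage z (G.p e) y := by
  simp only [kernelVoltage, kernel_point G ht, hat]
  ring

lemma slopeRight_kernelVoltage {e : E} {t : ℝ} (ht : t ∈ Ico 0 (G.len e))
    (z y : G.Point) :
    G.slopeRight (fun x => G.kernelVoltage z x y) e t =
      ((G.kernelVoltage z (G.q e) y - G.kernelVoltage z (G.p e) y) / G.len e -
        G.coord e y / G.len e + G.coord e z / G.len e) +
      ((if t < G.coord e y then 1 else 0) - if t < G.coord e z then 1 else 0) := by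
  refine HasDerivWithinAt.derivWithin ?_ (uniqueDiffWithinAt_Ioi t)
  have h := ((((hasDerivAt_id t).mul_const
    ((G.kernelVoltage z (G.q e) y - G.kernelVoltage z (G.p e) y) / G.len e -
        G.coord e y / G.len e + G.coord e z / G.len e)).hasDerivWithinAt (s := Ioi t)).add
    ((hasDerivWithinAt_min_Ioi (G.coord e y) t).sub
      (hasDerivWithinAt_min_Ioi (G.coord e z) t))).add_const (G.kernelVoltage z (G.p e) y)
  rw [one_mul] at h
  refine h.congr_of_eventuallyEq ?_ (kernelVoltage_point G ⟨ht.1, ht.2.le⟩ z y)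
  filter_upwards [Ioc_mem_nhdsGT ht.2] with s hs
  exact kernelVoltage_point G ⟨ht.1.trans hs.1.le, hs.2⟩ z y

lemma slopeLeft_kernelVoltage {e : E} {t : ℝ} (ht : t ∈ Ioc 0 (G.len e))
    (z y : G.Point) :
    G.slopeLeft (fun x => G.kernelVoltage z x y) e t =
      ((G.kernelVoltage z (G.q e) y - G.kernelVoltage z (G.p e) y) / G.len e -
        G.coord e y / G.len e + G.coord e z / G.len e) +
      ((if t ≤ G.coord e y then 1 else 0) - if t ≤ G.coord e z then 1 else 0) := by
  refine HasDerivWithinAt.derivWithin ?_ (uniqueDiffWithinAt_Iio t)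
  have h := ((((hasDerivAt_id t).mul_const
    ((G.kernelVoltage z (G.q e) y - G.kernelVoltage z (G.p e) y) / G.len e -
        G.coord e y / G.len e + G.coord e z / G.len e)).hasDerivWithinAt (s := Iio t)).add
    ((hasDerivWithinAt_min_Iio (G.coord e y) t).sub
      (hasDerivWithinAt_min_Iio (G.coord e z) t))).add_const (G.kernelVoltage z (G.p e) y)
  rw [one_mul] at h
  refine h.congr_of_eventuallyEq ?_ (kernelVoltage_point G ⟨ht.1.le, ht.2⟩ z y)
  filter_upwards [Ico_mem_nhdsLT ht.1] with s hs
  exact kernelVoltage_point G ⟨hs.1, hs.2.le.trans ht.2⟩ z y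

/-- The weights of a point, in terms of the slopes of the Dirichlet Green functions. -/
lemma weight_apply_eq_sum (y : G.Point) (v : V) :
    G.weight y v = indicator {y} (fun _ => (1 : ℝ)) (G.vertex v) +
      ∑ e, ((if G.src e = v then
          (if 0 < G.coord e y then 1 else 0) - G.coord e y / G.len e else 0) +
        if G.tgt e = v then G.coord e y / G.len e else 0) := by
  rcases G.exists_vertex_or_point y with ⟨w, rfl⟩ | ⟨e, t, ht, rfl⟩
  · simp only [weight_vertex, coord_vertex, indicator, mem_singleton_iff,
      G.vertex_injective.eq_iff]
    simp [Pi.single_apply]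
  · have hne : G.vertex v ∉ ({G.point e t} : Set G.Point) := fun h =>
      G.point_ne_vertex ht v (mem_singleton_iff.1 h).symm
    rw [indicator_of_notMem hne, zero_add, Finset.sum_eq_single e,
      coord_point_self G ⟨ht.1.le, ht.2⟩, weight_point G ⟨ht.1.le, ht.2.le⟩]
    · simp [ht.1, Pi.single_apply, eq_comm]
    · intro e' _ he
      simp [coord_point_of_ne G he.symm]
    · simp

/-- Each weight vector has total mass 1, so their difference is an admissible source; the terms
independent of `w` drop out. -/
lemma laplacian_kernelVoltage (z y : G.Point) (v : V) :
    G.laplacian (fun w => G.kernelVoltage z (G.vertex w) y) v = G.weight y v - G.weight z v := by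
  have h := G.laplacian_potential (b := G.weight y - G.weight z)
    (by simp [Finset.sum_sub_distrib, sum_weight]) v
  rw [potential_sub] at h
  rw [← Pi.sub_apply, ← h]
  simp only [laplacian, kernelVoltage, kernel_vertex, Pi.sub_apply]
  refine Finset.sum_congr rfl fun e _ => ?_
  ring

/-- The vertex potential solves the problem with the terminals spread to the ends of their edges.
The end slopes of `hat` undo this spreading at the vertices, and its kink puts the unit mass back at
the terminal. -/
theorem isVoltage_kernelVoltage (z y : G.Point) :
    G.IsVoltage z y fun x => G.kernelVoltage z x y := by
  refine ⟨fun e a b ha hab hb h => ?_, fun a => ?_, ?_⟩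
  · have key : ∀ w : G.Point, (∀ t ∈ Ioo a b, G.point e t ≠ w) →
        ∃ m c : ℝ, ∀ t ∈ Icc a b, min t (G.coord e w) = m * t + c := by
      intro w hw
      by_cases h1 : G.coord e w ≤ a
      · exact ⟨0, G.coord e w, fun t ht => by simp [h1.trans ht.1]⟩
      by_cases h2 : b ≤ G.coord e w
      · exact ⟨1, 0, fun t ht => by simp [ht.2.trans h2]⟩
      push Not at h1 h2
      exact absurd ((G.point_eq_iff_coord ⟨ha.trans_lt h1, h2.trans_le hb⟩ w).2 rfl)
        (hw _ ⟨h1, h2⟩)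
    obtain ⟨m₁, c₁, h₁⟩ := key y fun t ht => (h t ht).1
    obtain ⟨m₂, c₂, h₂⟩ := key z fun t ht => (h t ht).2
    refine ⟨((G.kernelVoltage z (G.q e) y - G.kernelVoltage z (G.p e) y) / G.len e -
        G.coord e y / G.len e + G.coord e z / G.len e) + m₁ - m₂,
        c₁ - c₂ + G.kernelVoltage z (G.p e) y, fun t ht => ?_⟩
    rw [kernelVoltage_point G ⟨ha.trans ht.1, ht.2.trans hb⟩, h₁ t ht, h₂ t ht]
    ring
  · rcases G.exists_vertex_or_point a with ⟨v, rfl⟩ | ⟨e, t, ht, rfl⟩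
    · have hy := G.weight_apply_eq_sum y v
      have hz := G.weight_apply_eq_sum z v
      have hl := G.laplacian_kernelVoltage z y v
      have : indicator {y} (fun _ => (1 : ℝ)) (G.vertex v) -
          indicator {z} (fun _ => (1 : ℝ)) (G.vertex v) =
          G.laplacian (fun w => G.kernelVoltage z (G.vertex w) y) v -
          ∑ e, ((if G.src e = v then
            (if 0 < G.coord e y then 1 else 0) - G.coord e y / G.len e else 0) +
            if G.tgt e = v then G.coord e y / G.len e else 0) +
          ∑ e, ((if G.src e = v then
            (if 0 < G.coord e z then 1 else 0) - G.coord e z / G.len e else 0) +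
            if G.tgt e = v then G.coord e z / G.len e else 0) := by
        rw [hl, hy, hz]; ring
      rw [this, slopeSum_vertex, laplacian, ← Finset.sum_neg_distrib, ← Finset.sum_sub_distrib,
        ← Finset.sum_add_distrib]
      refine Finset.sum_congr rfl fun e _ => ?_
      have hL := G.len_pos e
      rw [slopeRight_kernelVoltage G ⟨le_rfl, hL⟩,
        slopeLeft_kernelVoltage G ⟨hL, le_rfl⟩,
        -- Coordinates are strictly less than the length, so the `min` terms have left slope 0 at
        -- the far end.
        if_neg (not_le.2 (G.coord_mem_Ico e y).2), if_neg (not_le.2 (G.coord_mem_Ico e z).2)]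
      simp only [incidence, Pi.sub_apply, Pi.single_apply, p, q, @eq_comm V v]
      split_ifs <;> ring
    · rw [slopeSum_point G _ ht, slopeRight_kernelVoltage G ⟨ht.1.le, ht.2⟩,
        slopeLeft_kernelVoltage G ⟨ht.1, ht.2.le⟩]
      simp only [indicator, mem_singleton_iff, point_eq_iff_coord G ht]
      have key : ∀ c : ℝ, (if t ≤ c then (1 : ℝ) else 0) =
          (if t < c then 1 else 0) + if c = t then 1 else 0 := fun c => by
        rcases lt_trichotomy t c with h | h | h
        · simp [h, h.le, h.ne']
        · simp [h]
        · simp [h.not_ge, h.not_gt, h.ne]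
      rw [key, key]
      ring
  · simp [kernelVoltage]

end voltage

end

end MetrizedGraph

namespace MetrizedGraph

open MeasureTheory Set

set_option linter.unusedSectionVars false

noncomputable section

variable {V E : Type*} (G : MetrizedGraph V E)

/-! ### Voltage functions: uniqueness -/

section unique

variable [Fintype E] {G} {z y : G.Point} {f g : G.Point → ℝ}

lemma IsVoltage.exists_affine [DecidableEq E] (hf : G.IsVoltage z y f) {e : E} {a b : ℝ}
    (ha : 0 ≤ a) (hab : a ≤ b)
    (hb : b ≤ G.len e) (hy : G.coord e y ∉ Ioo a b) (hz : G.coord e z ∉ Ioo a b) :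
    ∃ m c : ℝ, ∀ t ∈ Icc a b, f (G.point e t) = m * t + c := by
  refine hf.affine e a b ha hab hb fun t ht => ?_
  have ht' : t ∈ Ioo 0 (G.len e) := ⟨ha.trans_lt ht.1, ht.2.trans_le hb⟩
  rw [Ne, Ne, point_eq_iff_coord G ht', point_eq_iff_coord G ht']
  exact ⟨fun h => hy (h ▸ ht), fun h => hz (h ▸ ht)⟩

lemma IsVoltage.differentiableWithinAt_Ioi (hf : G.IsVoltage z y f) {e : E} {t : ℝ}
    (ht : t ∈ Ico 0 (G.len e)) :
    DifferentiableWithinAt ℝ (fun s => f (G.point e s)) (Ioi t) t := by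
  classical
  obtain ⟨b, htb, hbL, hy, hz⟩ : ∃ b, t < b ∧ b ≤ G.len e ∧ G.coord e y ∉ Ioo t b ∧
      G.coord e z ∉ Ioo t b := by
    -- The nearest terminal beyond `t`, or the end of the edge if there is none.
    refine ⟨min (G.len e) (min (if t < G.coord e y then G.coord e y else G.len e)
      (if t < G.coord e z then G.coord e z else G.len e)), ?_, min_le_left _ _, ?_, ?_⟩
    · refine lt_min ht.2 (lt_min ?_ ?_) <;> split_ifs with h
      exacts [h, ht.2, h, ht.2]
    · rintro ⟨h1, h2⟩
      simp [h1] at h2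
    · rintro ⟨h1, h2⟩
      simp [h1] at h2
  obtain ⟨m, c, h⟩ := hf.exists_affine ht.1 htb.le hbL hy hz
  exact (hasDerivWithinAt_Ioi_of_affine htb h).differentiableWithinAt

lemma IsVoltage.differentiableWithinAt_Iio (hf : G.IsVoltage z y f) {e : E} {t : ℝ}
    (ht : t ∈ Ioc 0 (G.len e)) :
    DifferentiableWithinAt ℝ (fun s => f (G.point e s)) (Iio t) t := by
  classical
  obtain ⟨a, hat, ha, hy, hz⟩ : ∃ a, a < t ∧ 0 ≤ a ∧ G.coord e y ∉ Ioo a t ∧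
      G.coord e z ∉ Ioo a t := by
    refine ⟨max 0 (max (if G.coord e y < t then G.coord e y else 0)
      (if G.coord e z < t then G.coord e z else 0)), ?_, le_max_left _ _, ?_, ?_⟩
    · refine max_lt ht.1 (max_lt ?_ ?_) <;> split_ifs with h
      exacts [h, ht.1, h, ht.1]
    · rintro ⟨h1, h2⟩
      simp [h2] at h1
    · rintro ⟨h1, h2⟩
      simp [h2] at h1
  obtain ⟨m, c, h⟩ := hf.exists_affine ha hat.le ht.2 hy hz
  exact (hasDerivWithinAt_Iio_of_affine hat h).differentiableWithinAt

lemma IsVoltage.slopeRight_sub (hf : G.IsVoltage z y f) (hg : G.IsVoltage z y g) {e : E} {t : ℝ}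
    (ht : t ∈ Ico 0 (G.len e)) :
    G.slopeRight (f - g) e t = G.slopeRight f e t - G.slopeRight g e t :=
  derivWithin_fun_sub (hf.differentiableWithinAt_Ioi ht) (hg.differentiableWithinAt_Ioi ht)

lemma IsVoltage.slopeLeft_sub (hf : G.IsVoltage z y f) (hg : G.IsVoltage z y g) {e : E} {t : ℝ}
    (ht : t ∈ Ioc 0 (G.len e)) :
    G.slopeLeft (f - g) e t = G.slopeLeft f e t - G.slopeLeft g e t :=
  derivWithin_fun_sub (hf.differentiableWithinAt_Iio ht) (hg.differentiableWithinAt_Iio ht)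

lemma IsVoltage.slopeSum_eq (hf : G.IsVoltage z y f) (hg : G.IsVoltage z y g) (a : G.Point) :
    G.slopeSum f a = G.slopeSum g a :=
  neg_injective ((hf.kirchhoff a).trans (hg.kirchhoff a).symm)

/-- The kinks of two voltages with the same terminals cancel in the difference, so the three pieces
cut out by the terminals glue to one. -/
lemma IsVoltage.exists_affine_sub (hf : G.IsVoltage z y f) (hg : G.IsVoltage z y g) (e : E) :
    ∃ m c : ℝ, ∀ t ∈ Icc 0 (G.len e), (f - g) (G.point e t) = m * t + c := by
  classical
  have hy := G.coord_mem_Ico e y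
  have hz := G.coord_mem_Ico e z
  have jump : ∀ t, 0 < t → t < G.len e →
      derivWithin (fun s => (f - g) (G.point e s)) (Ioi t) t =
        derivWithin (fun s => (f - g) (G.point e s)) (Iio t) t := by
    intro t h0 h1
    have h := hf.slopeSum_eq hg (G.point e t)
    rw [slopeSum_point G _ ⟨h0, h1⟩, slopeSum_point G _ ⟨h0, h1⟩] at h
    have hr := hf.slopeRight_sub hg (e := e) ⟨h0.le, h1⟩
    have hl := hf.slopeLeft_sub hg (e := e) ⟨h0, h1.le⟩
    rw [slopeRight] at hr
    rw [slopeLeft] at hl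
    rw [hr, hl]
    linarith
  have piece : ∀ a b, 0 ≤ a → a ≤ b → b ≤ G.len e → G.coord e y ∉ Ioo a b →
      G.coord e z ∉ Ioo a b → ∃ m c : ℝ, ∀ t ∈ Icc a b, (f - g) (G.point e t) = m * t + c := by
    intro a b ha hab hb h1 h2
    obtain ⟨m, c, h⟩ := hf.exists_affine ha hab hb h1 h2
    obtain ⟨m', c', h'⟩ := hg.exists_affine ha hab hb h1 h2
    exact ⟨m - m', c - c', fun t ht => by rw [Pi.sub_apply, h t ht, h' t ht]; ring⟩
  have h1 : ∀ c, c = G.coord e y ∨ c = G.coord e z → c ≤ max (G.coord e y) (G.coord e z) ∧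
      min (G.coord e y) (G.coord e z) ≤ c := by
    rintro c (rfl | rfl) <;> simp
  have hmin : 0 ≤ min (G.coord e y) (G.coord e z) := le_min hy.1 hz.1
  have hmax : max (G.coord e y) (G.coord e z) < G.len e := max_lt hy.2 hz.2
  have hmm : min (G.coord e y) (G.coord e z) ≤ max (G.coord e y) (G.coord e z) := min_le_max
  refine exists_affine_of_derivWithin_eq (hmin.trans hmm) hmax.le
    (exists_affine_of_derivWithin_eq hmin hmm (piece _ _ le_rfl hmin (hmm.trans hmax.le) ?_ ?_)
      (piece _ _ hmin hmm hmax.le ?_ ?_) fun h h' => jump _ h (h'.trans hmax))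
      (piece _ _ (hmin.trans hmm) hmax.le le_rfl ?_ ?_) fun h h' => jump _ h h'
  · exact fun h => h.2.not_ge (min_le_left _ _)
  · exact fun h => h.2.not_ge (min_le_right _ _)
  · rintro ⟨h, h'⟩
    rcases le_total (G.coord e y) (G.coord e z) with hc | hc <;> simp_all
  · rintro ⟨h, h'⟩
    rcases le_total (G.coord e y) (G.coord e z) with hc | hc <;> simp_all
  · exact fun h => h.1.not_ge (le_max_left _ _)
  · exact fun h => h.1.not_ge (le_max_right _ _)

/-- The difference is affine on every edge and harmonic at the vertices, hence constant, and it
vanishes at `z`. -/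
theorem IsVoltage.unique [Finite V] (hf : G.IsVoltage z y f) (hg : G.IsVoltage z y g) : f = g := by
  classical
  have := Fintype.ofFinite V
  choose m c hmc using hf.exists_affine_sub hg
  have hp : ∀ e, (f - g) (G.p e) = c e := fun e => by
    rw [← point_zero, hmc e 0 ⟨le_rfl, (G.len_pos e).le⟩]; ring
  have hq : ∀ e, (f - g) (G.q e) = m e * G.len e + c e := fun e => by
    rw [← point_len, hmc e _ ⟨(G.len_pos e).le, le_rfl⟩]
  have hlap : ∀ v, G.laplacian (fun w => (f - g) (G.vertex w)) v = 0 := by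
    intro v
    have h := hf.slopeSum_eq hg (G.vertex v)
    rw [slopeSum_vertex, slopeSum_vertex, ← sub_eq_zero, ← Finset.sum_sub_distrib] at h
    rw [← neg_eq_zero, laplacian, ← Finset.sum_neg_distrib, ← h]
    refine Finset.sum_congr rfl fun e _ => ?_
    have hL := G.len_pos e
    have hr := hf.slopeRight_sub hg (e := e) (t := 0) ⟨le_rfl, hL⟩
    have hl := hf.slopeLeft_sub hg (e := e) (t := G.len e) ⟨hL, le_rfl⟩
    rw [slopeRight, (hasDerivWithinAt_Ioi_of_affine hL (hmc e)).derivWithin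
      (uniqueDiffWithinAt_Ioi _)] at hr
    rw [slopeLeft, (hasDerivWithinAt_Iio_of_affine hL (hmc e)).derivWithin
      (uniqueDiffWithinAt_Iio _)] at hl
    have hd : ((f - g) (G.vertex (G.src e)) - (f - g) (G.vertex (G.tgt e))) / G.len e = - m e := by
      rw [← p, ← q, hp, hq]
      field_simp; ring
    rw [hd]
    simp only [incidence, Pi.sub_apply, Pi.single_apply, @eq_comm V v]
    split_ifs <;> linarith
  have hvc := G.eq_of_laplacian_eq_zero hlap
  have hm : ∀ e, m e = 0 := fun e => by
    have h : (f - g) (G.p e) = (f - g) (G.q e) := hvc (G.src e) (G.tgt e)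
    rw [hp, hq] at h
    rcases mul_eq_zero.1 (by linarith : m e * G.len e = 0) with h | h
    · exact h
    · exact absurd h (G.len_pos e).ne'
  have hrep : ∀ a, ∃ v, (f - g) a = (f - g) (G.vertex v) := by
    intro a
    rcases G.exists_vertex_or_point a with ⟨v, rfl⟩ | ⟨e, t, ht, rfl⟩
    · exact ⟨v, rfl⟩
    · refine ⟨G.src e, ?_⟩
      rw [← p, hp, hmc e t ⟨ht.1.le, ht.2.le⟩, hm]; ring
  have hz : (f - g) z = 0 := by rw [Pi.sub_apply, hf.ground, hg.ground, sub_zero]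
  funext a
  obtain ⟨v, hv⟩ := hrep a
  obtain ⟨w, hw⟩ := hrep z
  have h : (f - g) a = 0 := by rw [hv, hvc v w]; exact hw.symm.trans hz
  exact sub_eq_zero.1 h

end unique

/-! ### Voltage and resistance in terms of the kernel -/

section voltage

variable [DecidableEq V] [DecidableEq E] [Fintype V] [Fintype E] [Nonempty V]

theorem voltage_eq (z x y : G.Point) : G.voltage z x y = G.kernelVoltage z x y :=
  congrFun ((Classical.epsilon_spec ⟨_, G.isVoltage_kernelVoltage z y⟩).unique
    (G.isVoltage_kernelVoltage z y)) x

theorem resistance_eq (x y : G.Point) :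
    G.resistance x y = G.kernel x x - 2 * G.kernel x y + G.kernel y y := by
  rw [resistance, voltage_eq, kernelVoltage, kernel_comm G y x]
  ring

lemma resistance_comm (x y : G.Point) : G.resistance x y = G.resistance y x := by
  rw [resistance_eq, resistance_eq, kernel_comm G y x]
  ring

/-- The resistance to a vertex is quadratic on every edge. -/
lemma resistance_vertex_point (v : V) {e : E} {t : ℝ} (ht : t ∈ Icc 0 (G.len e)) :
    G.resistance (G.vertex v) (G.point e t) =
      G.resistance (G.vertex v) (G.p e) +
      t * ((G.len e - G.resistance (G.p e) (G.q e) + G.resistance (G.vertex v) (G.q e)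
        - G.resistance (G.vertex v) (G.p e)) / G.len e) -
      t ^ 2 * ((G.len e - G.resistance (G.p e) (G.q e)) / G.len e ^ 2) := by
  have hL := (G.len_pos e).ne'
  have h0 : G.hat e t 0 = 0 := by rw [hat_comm, hat_zero_left _ _ ht.1]
  simp only [resistance_eq]
  rw [kernel_comm G (G.vertex v) (G.point e t), kernel_point G ht, kernel_point_self G ht,
    coord_vertex, h0, kernel_comm G (G.p e) (G.vertex v), kernel_comm G (G.q e) (G.vertex v)]
  field_simp
  ring

end voltage

end

end MetrizedGraph

namespace MetrizedGraph

open MeasureTheory Set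

set_option linter.unusedSectionVars false

noncomputable section

variable {V E : Type*} (G : MetrizedGraph V E)

/-! ### Integration of continuous functions against signed measures -/

section integral

variable [Finite V] [Finite E] {G}

instance isFiniteMeasure_variation {X : Type*} [MeasurableSpace X] (μ : SignedMeasure X) :
    IsFiniteMeasure (VectorMeasure.variation μ) := by
  rw [← SignedMeasure.totalVariation_eq_variation]
  infer_instance

lemma integrable_of_continuous (μ : SignedMeasure G.Point) {f : G.Point → ℝ} (hf : Continuous f) :
    μ.Integrable f := by
  obtain ⟨C, hC⟩ := (isCompact_range hf).isBounded.exists_norm_le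
  exact Integrable.of_bound hf.aestronglyMeasurable C
    (Filter.Eventually.of_forall fun x => hC _ (mem_range_self x))

lemma integral_const_signedMeasure (μ : SignedMeasure G.Point) (c : ℝ) :
    (∫ᵛ _, c ∂•μ) = c * μ univ := by
  rw [VectorMeasure.integral_const]
  simp

lemma integral_add_signedMeasure (μ : SignedMeasure G.Point) {f g : G.Point → ℝ}
    (hf : Continuous f) (hg : Continuous g) :
    (∫ᵛ x, (f x + g x) ∂•μ) = (∫ᵛ x, f x ∂•μ) + ∫ᵛ x, g x ∂•μ :=
  VectorMeasure.integral_fun_add (integrable_of_continuous μ hf) (integrable_of_continuous μ hg)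

lemma integral_sub_signedMeasure (μ : SignedMeasure G.Point) {f g : G.Point → ℝ}
    (hf : Continuous f) (hg : Continuous g) :
    (∫ᵛ x, (f x - g x) ∂•μ) = (∫ᵛ x, f x ∂•μ) - ∫ᵛ x, g x ∂•μ :=
  VectorMeasure.integral_fun_sub (integrable_of_continuous μ hf) (integrable_of_continuous μ hg)

lemma integral_mul_signedMeasure (μ : SignedMeasure G.Point) (c : ℝ) (f : G.Point → ℝ) :
    (∫ᵛ x, c * f x ∂•μ) = c * ∫ᵛ x, f x ∂•μ :=
  VectorMeasure.integral_fun_smul μ _ c f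

variable (G) in
/-- The Lebesgue measure of the edge `e`. -/
def edgeMeasure (e : E) : SignedMeasure G.Point :=
  ((volume.restrict (Ioc 0 (G.len e))).map (G.point e)).toSignedMeasure

lemma integral_edgeMeasure (e : E) {f : G.Point → ℝ} (hf : Continuous f) :
    (∫ᵛ x, f x ∂•(G.edgeMeasure e)) = ∫ t in (0)..G.len e, f (G.point e t) := by
  -- Multiplication of reals is commutative, so the pairing can be flipped into the form used for
  -- integrals against `toSignedMeasure`.
  have hflip : (ContinuousLinearMap.lsmul ℝ ℝ : ℝ →L[ℝ] ℝ →L[ℝ] ℝ) =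
      (ContinuousLinearMap.lsmul ℝ ℝ).flip := by ext; simp
  rw [hflip, edgeMeasure, VectorMeasure.integral_toSignedMeasure,
    integral_map (G.continuous_point e).aemeasurable hf.aestronglyMeasurable,
    intervalIntegral.integral_of_le (G.len_pos e).le]

variable (G) in
/-- The signed measure with the given masses at the vertices and the given constant densities on
the edges. -/
def signedMeasureOf [Fintype V] [Fintype E] (m : V → ℝ) (c : E → ℝ) : SignedMeasure G.Point :=
  ∑ v, VectorMeasure.dirac (G.vertex v) (m v) + ∑ e, c e • G.edgeMeasure e

lemma integral_signedMeasureOf [Fintype V] [Fintype E] (m : V → ℝ) (c : E → ℝ) {f : G.Point → ℝ}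
    (hf : Continuous f) :
    (∫ᵛ x, f x ∂•(G.signedMeasureOf m c)) =
      ∑ v, m v * f (G.vertex v) + ∑ e, c e * ∫ t in (0)..G.len e, f (G.point e t) := by
  have hi := fun μ : SignedMeasure G.Point => integrable_of_continuous μ hf
  rw [signedMeasureOf, VectorMeasure.integral_add_vectorMeasure (hi _) (hi _),
    VectorMeasure.integral_finsetSum_vectorMeasure fun _ _ => hi _,
    VectorMeasure.integral_finsetSum_vectorMeasure fun _ _ => hi _]
  congr 1
  · refine Finset.sum_congr rfl fun v _ => ?_
    rw [VectorMeasure.integral_dirac' hf.stronglyMeasurable]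
    simp [mul_comm]
  · refine Finset.sum_congr rfl fun e _ => ?_
    rw [VectorMeasure.integral_smul_vectorMeasure, integral_edgeMeasure e hf, smul_eq_mul]

end integral

/-! ### Existence of the canonical measure -/

lemma integral_min_id (c L : ℝ) (h0 : 0 ≤ c) (h1 : c ≤ L) :
    ∫ t in (0)..L, min t c = c * L - c ^ 2 / 2 := by
  have hi : ∀ a b, IntervalIntegrable (fun t => min t c) volume a b := fun a b =>
    (by fun_prop : Continuous fun t : ℝ => min t c).intervalIntegrable a b
  rw [← intervalIntegral.integral_add_adjacent_intervals (hi 0 c) (hi c L),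
    intervalIntegral.integral_congr (g := fun t => t) (a := 0),
    intervalIntegral.integral_congr (g := fun _ => c) (a := c)]
  · simp; ring
  · intro t ht
    rw [uIcc_of_le h1] at ht
    simp [ht.1]
  · intro t ht
    rw [uIcc_of_le h0] at ht
    simp [ht.2]

section canonical

variable [DecidableEq V] [DecidableEq E] [Fintype V] [Fintype E] [Nonempty V]

/-- The trapezoidal value of the affine part plus the integral of the Dirichlet Green function. -/
lemma integral_kernel_point (e : E) (x : G.Point) :
    ∫ t in (0)..G.len e, G.kernel (G.point e t) x =
      G.len e / 2 * (G.kernel (G.p e) x + G.kernel (G.q e) x) +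
        G.coord e x * (G.len e - G.coord e x) / 2 := by
  have hL := G.len_pos e
  have hc := G.coord_mem_Ico e x
  have h : ∀ t ∈ uIcc 0 (G.len e), G.kernel (G.point e t) x =
      t * ((G.kernel (G.q e) x - G.kernel (G.p e) x) / G.len e - G.coord e x / G.len e) +
        (min t (G.coord e x) + G.kernel (G.p e) x) := fun t ht => by
    rw [uIcc_of_le hL.le] at ht
    rw [kernel_point G ht, hat]; ring
  have h1 : IntervalIntegrable (fun t : ℝ =>
      t * ((G.kernel (G.q e) x - G.kernel (G.p e) x) / G.len e - G.coord e x / G.len e))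
      volume 0 (G.len e) := (by fun_prop : Continuous _).intervalIntegrable _ _
  have h2 : IntervalIntegrable (fun t : ℝ => min t (G.coord e x)) volume 0 (G.len e) :=
    (by fun_prop : Continuous _).intervalIntegrable _ _
  rw [intervalIntegral.integral_congr h, intervalIntegral.integral_add h1
    (h2.add intervalIntegrable_const), intervalIntegral.integral_add h2 intervalIntegrable_const,
    integral_min_id _ _ hc.1 hc.2.le]
  simp only [intervalIntegral.integral_mul_const, integral_id, intervalIntegral.integral_const,
    smul_eq_mul]
  field_simp
  ring

lemma voltageIntegral_eq {μ : SignedMeasure G.Point} (hμ : μ univ = 1) (x y : G.Point) :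
    G.voltageIntegral μ x y = G.kernel x y - (∫ᵛ z, G.kernel z x ∂•μ) - (∫ᵛ z, G.kernel z y ∂•μ) +
      ∫ᵛ z, G.kernel z z ∂•μ := by
  have h1 := G.continuous_kernel x
  have h2 := G.continuous_kernel y
  have h3 := G.continuous_kernel_self
  simp only [voltageIntegral, voltage_eq, kernelVoltage, kernel_comm G x]
  rw [integral_add_signedMeasure μ (by fun_prop) h3,
    integral_sub_signedMeasure μ (by fun_prop) h2,
    integral_sub_signedMeasure μ continuous_const h1, integral_const_signedMeasure, hμ, mul_one]

/-- The diagonal of j_μ is constant once 2∫ k(z,x) dμ(z) = k(x,x) + κ for a constant κ. Edge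
densities match the quadratic part of k(x,x) along the edges, vertex masses match its values at the
vertices, and κ is fixed by the total mass. -/
theorem exists_isCanonicalMeasure : ∃ μ, G.IsCanonicalMeasure μ := by
  have hV : (Fintype.card V : ℝ) ≠ 0 := by simp
  let d : V → ℝ := fun v => G.kernel (G.vertex v) (G.vertex v)
  -- Minus the coefficient of t² in k(x,x) along `e`.
  let c : E → ℝ := fun e => 1 / G.len e - G.resistance (G.p e) (G.q e) / G.len e ^ 2
  obtain ⟨κ, hκ⟩ : ∃ κ : ℝ, Fintype.card V * ∑ v, (1 / 2 * (d v + κ)) = 1 := by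
    refine ⟨(2 / Fintype.card V - ∑ v, d v) / Fintype.card V, ?_⟩
    rw [← Finset.mul_sum, Finset.sum_add_distrib]
    simp only [Finset.sum_const, Finset.card_univ, nsmul_eq_mul]
    field_simp
    ring
  -- Chosen so that its potential is half of the diagonal plus κ at every vertex; κ above makes its
  -- total mass 1.
  let β : V → ℝ := G.laplacianAddOnes.mulVec fun v => 1 / 2 * (d v + κ)
  have hβ : ∑ v, β v = 1 := by rw [← hκ]; exact G.sum_laplacianAddOnes_mulVec _
  have hpot : G.potential β = fun v => 1 / 2 * (d v + κ) := G.potential_laplacianAddOnes_mulVec _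
  -- Half of the mass of each edge is removed at either end, which cancels the trapezoidal term of
  -- `integral_kernel_point`.
  let m : V → ℝ := fun v => β v - ∑ e, c e * G.len e / 2 *
    ((Pi.single (G.src e) 1 : V → ℝ) v + (Pi.single (G.tgt e) 1 : V → ℝ) v)
  have hm : ∀ u : V → ℝ, ∑ v, m v * u v =
      ∑ v, β v * u v - ∑ e, c e * G.len e / 2 * (u (G.src e) + u (G.tgt e)) := by
    intro u
    simp only [m, sub_mul, Finset.sum_sub_distrib, Finset.sum_mul]
    rw [Finset.sum_comm]
    congr 1
    refine Finset.sum_congr rfl fun e _ => ?_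
    simp only [mul_assoc, add_mul, ← Finset.mul_sum, Finset.sum_add_distrib]
    simp [Pi.single_apply]
  have huniv : G.signedMeasureOf m c univ = 1 := by
    have h := integral_signedMeasureOf (G := G) m c (f := fun _ => (1 : ℝ)) continuous_const
    rw [integral_const_signedMeasure, one_mul] at h
    rw [h, hm]
    simp only [intervalIntegral.integral_const, smul_eq_mul, mul_one, sub_zero, hβ]
    rw [sub_add, ← Finset.sum_sub_distrib, sub_eq_self]
    exact Finset.sum_eq_zero fun e _ => by ring
  have hint : ∀ x, (∫ᵛ z, G.kernel z x ∂•(G.signedMeasureOf m c)) =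
      1 / 2 * (∑ v, G.weight x v * d v + κ) +
        ∑ e, c e * (G.coord e x * (G.len e - G.coord e x) / 2) := by
    intro x
    have hβx : ∑ v, β v * G.kernel (G.vertex v) x = 1 / 2 * (∑ v, G.weight x v * d v + κ) := by
      simp only [kernel_vertex]
      have h := G.dotProduct_potential_comm β (G.weight x)
      rw [hpot] at h
      simp only [dotProduct] at h
      have hw : κ = ∑ v, G.weight x v * κ := by rw [← Finset.sum_mul, sum_weight, one_mul]
      rw [h]
      conv_rhs => rw [hw]
      rw [← Finset.sum_add_distrib, Finset.mul_sum]
      exact Finset.sum_congr rfl fun v _ => by ring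
    rw [integral_signedMeasureOf m c (G.continuous_kernel x), hm, hβx]
    rw [sub_add_eq_add_sub, add_sub_assoc, ← Finset.sum_sub_distrib]
    congr 1
    refine Finset.sum_congr rfl fun e _ => ?_
    rw [integral_kernel_point, p, q]
    ring
  refine ⟨G.signedMeasureOf m c, huniv, -κ + ∫ᵛ z, G.kernel z z ∂•(G.signedMeasureOf m c),
    fun x => ?_⟩
  rw [voltageIntegral_eq G huniv, hint]
  rcases G.exists_vertex_or_point x with ⟨v, rfl⟩ | ⟨e, t, ht, rfl⟩
  · simp only [weight_vertex, coord_vertex]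
    simp [d, Pi.single_apply]
    ring
  · have ht' : t ∈ Icc 0 (G.len e) := ⟨ht.1.le, ht.2.le⟩
    have hL := (G.len_pos e).ne'
    rw [Finset.sum_eq_single e, coord_point_self G ⟨ht.1.le, ht.2⟩]
    · have hw : ∑ v, G.weight (G.point e t) v * d v =
          (1 - t / G.len e) * G.kernel (G.p e) (G.p e) + t / G.len e * G.kernel (G.q e) (G.q e) := by
        rw [weight_point G ht']
        simp [add_mul, Finset.sum_add_distrib, Pi.single_apply, d, p, q]
      rw [hw, kernel_point_self G ht']
      simp only [c, resistance_eq]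
      field_simp
      ring
    · intro e' _ he
      simp [coord_point_of_ne G he.symm]
    · simp

lemma isCanonicalMeasure_canonicalMeasure : G.IsCanonicalMeasure G.canonicalMeasure :=
  Classical.epsilon_spec G.exists_isCanonicalMeasure

lemma voltageIntegral_canonicalMeasure (x : G.Point) :
    G.voltageIntegral G.canonicalMeasure x x = 2 * G.tau := by
  obtain ⟨-, c, hc⟩ := G.isCanonicalMeasure_canonicalMeasure
  rw [tau, hc, hc]
  ring

/-- The Arakelov-Green function of the canonical measure in terms of the effective resistance. -/
theorem greenCan_eq (x y : G.Point) : G.greenCan x y = G.tau - 1 / 2 * G.resistance x y := by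
  have hu := G.isCanonicalMeasure_canonicalMeasure.1
  have hj : ∀ x y, (∫ᵛ z, G.voltage z x y ∂•G.canonicalMeasure) =
      2 * G.tau - 1 / 2 * G.resistance x y := by
    intro x y
    have h := G.voltageIntegral_eq hu x y
    -- The half-sum of the two diagonal identities eliminates the one-variable integrals.
    have hx := G.voltageIntegral_eq hu x x
    have hy := G.voltageIntegral_eq hu y y
    rw [voltageIntegral_canonicalMeasure] at hx hy
    rw [resistance_eq]
    rw [voltageIntegral] at h
    rw [h]
    linarith
  -- By symmetry r(x,y) = j_x(y,y), so this integral is again the diagonal of j_μ.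
  have hr : ∀ y, (∫ᵛ x, G.resistance x y ∂•G.canonicalMeasure) = 2 * G.tau := by
    intro y
    rw [← G.voltageIntegral_canonicalMeasure y, voltageIntegral]
    congr 1
    funext z
    rw [resistance_comm, resistance]
  have hcont : ∀ y, Continuous fun x => G.resistance x y := fun y => by
    simp only [resistance_eq]
    exact (G.continuous_kernel_self.sub ((G.continuous_kernel y).const_mul 2)).add continuous_const
  have hin : ∀ y, (∫ᵛ x, (2 * G.tau - 1 / 2 * G.resistance x y) ∂•G.canonicalMeasure) = G.tau := by
    intro y
    rw [integral_sub_signedMeasure _ continuous_const ((hcont y).const_mul _),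
      integral_const_signedMeasure, integral_mul_signedMeasure, hr, hu]
    ring
  rw [greenCan, arakelovGreen]
  simp only [hj, hin]
  rw [integral_const_signedMeasure, hu]
  ring

end canonical

end

end MetrizedGraph

namespace MetrizedGraph

open MeasureTheory Set

set_option linter.unusedSectionVars false

noncomputable section

variable {V E : Type*} (G : MetrizedGraph V E)

/-! ### The two sides of a bridge -/

lemma vertex_mem_deleteEdge (i : E) (v : V) : G.vertex v ∈ G.deleteEdge i := by
  rintro ⟨t, ht, h⟩
  exact G.point_ne_vertex ht v h

lemma point_mem_deleteEdge {i e : E} (h : e ≠ i) (t : ℝ) : G.point e t ∈ G.deleteEdge i := by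
  rintro ⟨t', ht', h'⟩
  exact h (G.edge_eq_of_point_eq ht' h'.symm)

lemma vertex_or_point_of_mem_deleteEdge {i : E} {a : G.Point} (ha : a ∈ G.deleteEdge i) :
    (∃ v, a = G.vertex v) ∨ ∃ e ≠ i, ∃ t ∈ Ioo 0 (G.len e), a = G.point e t := by
  rcases G.exists_vertex_or_point a with h | ⟨e, t, ht, rfl⟩
  · exact Or.inl h
  · refine Or.inr ⟨e, ?_, t, ht, rfl⟩
    rintro rfl
    exact ha ⟨t, ht, rfl⟩

lemma joinedIn_point {F : Set G.Point} {e : E} {a b : ℝ} (h : ∀ t ∈ uIcc a b, G.point e t ∈ F) :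
    JoinedIn F (G.point e a) (G.point e b) := by
  have h1 : IsPathConnected (G.point e '' uIcc a b) :=
    ((convex_uIcc a b).isPathConnected nonempty_uIcc).image (G.continuous_point e)
  refine (h1.joinedIn _ (mem_image_of_mem _ left_mem_uIcc) _
    (mem_image_of_mem _ right_mem_uIcc)).mono ?_
  rintro _ ⟨t, ht, rfl⟩
  exact h t ht

lemma joinedIn_deleteEdge {i e : E} (h : e ≠ i) (t : ℝ) :
    JoinedIn (G.deleteEdge i) (G.p e) (G.point e t) := by
  rw [← point_zero]
  exact G.joinedIn_point fun t _ => G.point_mem_deleteEdge h t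

/-- The vertices on the side of `p i`. -/
def side (i : E) : Set V := {v | JoinedIn (G.deleteEdge i) (G.p i) (G.vertex v)}

lemma src_mem_side (i : E) : G.src i ∈ G.side i :=
  JoinedIn.refl (G.vertex_mem_deleteEdge i _)

lemma src_mem_side_iff {i e : E} (h : e ≠ i) : G.src e ∈ G.side i ↔ G.tgt e ∈ G.side i := by
  have h1 : JoinedIn (G.deleteEdge i) (G.vertex (G.src e)) (G.vertex (G.tgt e)) := by
    have := G.joinedIn_deleteEdge h (G.len e)
    rwa [point_len] at this
  exact ⟨fun h2 => JoinedIn.trans h2 h1, fun h2 => JoinedIn.trans h2 h1.symm⟩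

/-- Being joined to one of the two ends is a property that passes along every edge, `i` included, so
it holds everywhere by connectedness. -/
lemma mem_side_or (i : E) (v : V) :
    v ∈ G.side i ∨ JoinedIn (G.deleteEdge i) (G.q i) (G.vertex v) := by
  have h := G.eq_of_forall_edge
    (u := fun v => v ∈ G.side i ∨ JoinedIn (G.deleteEdge i) (G.q i) (G.vertex v)) (fun e => ?_)
    v (G.src i)
  · exact h.mpr (Or.inl (G.src_mem_side i))
  · by_cases he : e = i
    · subst he
      exact propext (iff_of_true (Or.inl (G.src_mem_side e))
        (Or.inr (JoinedIn.refl (G.vertex_mem_deleteEdge e _))))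
    · have h1 : JoinedIn (G.deleteEdge i) (G.vertex (G.src e)) (G.vertex (G.tgt e)) := by
        have := G.joinedIn_deleteEdge he (G.len e)
        rwa [point_len] at this
      exact propext (or_congr (G.src_mem_side_iff he)
        ⟨fun h2 => h2.trans h1, fun h2 => h2.trans h1.symm⟩)

/-- Otherwise every vertex, and then every point off the interior of `i`, could be joined to `p i`.
-/
lemma IsBridge.tgt_notMem_side {G : MetrizedGraph V E} {i : E} (h : G.IsBridge i) :
    G.tgt i ∉ G.side i := by
  intro ht
  have hv : ∀ v, v ∈ G.side i := fun v =>
    (G.mem_side_or i v).elim id fun h => JoinedIn.trans ht h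
  refine h (IsPathConnected.isConnected ⟨G.p i, G.vertex_mem_deleteEdge i _, fun {a} ha => ?_⟩)
  rcases G.vertex_or_point_of_mem_deleteEdge ha with ⟨v, rfl⟩ | ⟨e, he, t, -, rfl⟩
  · exact hv v
  · exact JoinedIn.trans (hv (G.src e)) (G.joinedIn_deleteEdge he t)

/-! ### The cut function of an edge -/

section cut

variable [DecidableEq V] [Fintype V]

/-- The piecewise affine function on `Γ` with the given values at the vertices. -/
def interpolate (u : V → ℝ) (x : G.Point) : ℝ := ∑ v, G.weight x v * u v

variable {G}

lemma interpolate_vertex (u : V → ℝ) (v : V) : G.interpolate u (G.vertex v) = u v := by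
  simp [interpolate, weight_vertex, Pi.single_apply]

lemma interpolate_point (u : V → ℝ) {e : E} {t : ℝ} (ht : t ∈ Icc 0 (G.len e)) :
    G.interpolate u (G.point e t) =
      (1 - t / G.len e) * u (G.src e) + t / G.len e * u (G.tgt e) := by
  simp [interpolate, weight_point G ht, add_mul, Finset.sum_add_distrib, Pi.single_apply]

lemma continuous_interpolate (u : V → ℝ) : Continuous (G.interpolate u) :=
  G.continuous_of_point fun e => ContinuousOn.congr (by fun_prop) fun _ ht =>
    interpolate_point u ht

variable (G) in
open Classical in
/-- The function that is `1` on the side of `p i`, `0` on the side of `q i`, and affine on the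
edge `i`. -/
def cut (i : E) : G.Point → ℝ := G.interpolate fun v => if v ∈ G.side i then 1 else 0

lemma cut_p (i : E) : G.cut i (G.p i) = 1 := by
  rw [cut, p, interpolate_vertex, if_pos (G.src_mem_side i)]

lemma IsBridge.cut_q {i : E} (h : G.IsBridge i) : G.cut i (G.q i) = 0 := by
  rw [cut, q, interpolate_vertex, if_neg h.tgt_notMem_side]

lemma cut_point_of_mem {i j : E} (hij : j ≠ i) {t : ℝ} (ht : t ∈ Icc 0 (G.len j))
    (h : G.src j ∈ G.side i) : G.cut i (G.point j t) = 1 := by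
  rw [cut, interpolate_point _ ht, if_pos h, if_pos ((G.src_mem_side_iff hij).1 h)]
  ring

lemma cut_point_of_notMem {i j : E} (hij : j ≠ i) {t : ℝ} (ht : t ∈ Icc 0 (G.len j))
    (h : G.src j ∉ G.side i) : G.cut i (G.point j t) = 0 := by
  rw [cut, interpolate_point _ ht, if_neg h, if_neg (mt (G.src_mem_side_iff hij).2 h)]
  ring

lemma cut_eq_zero_or_one {i : E} {a : G.Point} (ha : a ∈ G.deleteEdge i) :
    G.cut i a = 0 ∨ G.cut i a = 1 := by
  rcases G.vertex_or_point_of_mem_deleteEdge ha with ⟨v, rfl⟩ | ⟨e, he, t, ht, rfl⟩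
  · rw [cut, interpolate_vertex]
    split_ifs <;> simp
  · by_cases h : G.src e ∈ G.side i
    · exact Or.inr (cut_point_of_mem he ⟨ht.1.le, ht.2.le⟩ h)
    · exact Or.inl (cut_point_of_notMem he ⟨ht.1.le, ht.2.le⟩ h)

/-- A continuous function with values 0 and 1 cannot pass through 1/2. This links connected
components and paths to the combinatorial `side`. -/
lemma cut_eq_of_isPreconnected {i : E} {C : Set G.Point} (hC : IsPreconnected C)
    (hsub : C ⊆ G.deleteEdge i) {a b : G.Point} (ha : a ∈ C) (hb : b ∈ C) :
    G.cut i a = G.cut i b := by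
  have key : ∀ a ∈ C, ∀ b ∈ C, G.cut i a = 0 → G.cut i b = 1 → False := by
    intro a ha b hb h0 h1
    obtain ⟨c, hc, hc'⟩ := hC.intermediate_value ha hb (continuous_interpolate _).continuousOn
      (show (1 / 2 : ℝ) ∈ Icc (G.cut i a) (G.cut i b) by rw [h0, h1]; norm_num)
    change G.cut i c = 1 / 2 at hc'
    rcases cut_eq_zero_or_one (hsub hc) with h | h <;> rw [h] at hc' <;> norm_num at hc'
  rcases cut_eq_zero_or_one (hsub ha) with h | h <;>
    rcases cut_eq_zero_or_one (hsub hb) with h' | h'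
  · rw [h, h']
  · exact (key a ha b hb h h').elim
  · exact (key b hb a ha h' h).elim
  · rw [h, h']

lemma cut_eq_of_onSide {i : E} {v : V} {y : G.Point} (h : G.OnSide i (G.vertex v) y) :
    G.cut i y = G.cut i (G.vertex v) :=
  cut_eq_of_isPreconnected isPreconnected_connectedComponentIn
    (connectedComponentIn_subset _ _) h
    (mem_connectedComponentIn (G.vertex_mem_deleteEdge i v))

end cut

lemma onSide_of_joinedIn {i : E} {a y : G.Point} (h : JoinedIn (G.deleteEdge i) a y) :
    G.OnSide i a y := by
  obtain ⟨γ, hγ⟩ := h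
  refine (isPreconnected_range γ.continuous).subset_connectedComponentIn (x := a) ?_ ?_ ?_
  · exact ⟨0, γ.source⟩
  · rintro _ ⟨t, rfl⟩; exact hγ t
  · exact ⟨1, γ.target⟩

lemma onSide_p_or_q {i j : E} (hij : j ≠ i) (t : ℝ) :
    G.OnSide i (G.p i) (G.point j t) ∨ G.OnSide i (G.q i) (G.point j t) := by
  rcases G.mem_side_or i (G.src j) with h | h
  · exact Or.inl (G.onSide_of_joinedIn (JoinedIn.trans h (G.joinedIn_deleteEdge hij t)))
  · exact Or.inr (G.onSide_of_joinedIn (JoinedIn.trans h (G.joinedIn_deleteEdge hij t)))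

/-! ### Betweenness -/

variable {G}

lemma Between.symm {a x y : G.Point} (h : G.Between a x y) : G.Between a y x := fun γ => by
  simpa using h γ.symm

/-- The second path keeps the cut value of `b`, hence never meets `a`; concatenation avoids `a`
altogether. -/
lemma not_between_of_cut_ne [DecidableEq V] [Fintype V] {i : E} {a b x y : G.Point}
    (hx : JoinedIn {a}ᶜ x b)
    (hy : JoinedIn (G.deleteEdge i) b y) (hab : G.cut i a ≠ G.cut i b) : ¬ G.Between a x y := by
  have hy' : JoinedIn {a}ᶜ b y := by
    obtain ⟨γ, hγ⟩ := hy
    refine ⟨γ, fun t ht => hab ?_⟩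
    rw [← mem_singleton_iff.1 ht]
    exact cut_eq_of_isPreconnected (isPreconnected_range γ.continuous)
      (by rintro _ ⟨t, rfl⟩; exact hγ t) (mem_range_self t) ⟨0, γ.source⟩
  obtain ⟨γ, hγ⟩ := hx.trans hy'
  intro h
  obtain ⟨t, ht⟩ := h γ
  exact hγ t ht

/-- If `j` were on the other side, one could leave through `q i` without meeting `p i`. The
parameter 0 is excluded because there the point is `p i` itself and betweenness says nothing. -/
lemma IsBridge.src_mem_side_of_between [Finite V] {i j : E} (hi : G.IsBridge i) (hij : j ≠ i)
    {s t : ℝ} (hs : s ∈ Ioc 0 (G.len i))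
    (h : G.Between (G.p i) (G.point i s) (G.point j t)) : G.src j ∈ G.side i := by
  classical
  have := Fintype.ofFinite V
  by_contra hj
  refine not_between_of_cut_ne (i := i) (b := G.q i) ?_
    (((G.mem_side_or i _).resolve_left hj).trans (G.joinedIn_deleteEdge hij t)) ?_ h
  · rw [← point_len]
    refine G.joinedIn_point fun t' ht' ht'' => ?_
    rw [uIcc_of_le hs.2] at ht'
    rw [mem_singleton_iff] at ht''
    rcases ht'.2.eq_or_lt with h1 | h1
    · rw [h1, point_len, eq_comm, p_eq_q_iff] at ht''
      exact hi.tgt_notMem_side (ht'' ▸ G.src_mem_side i)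
    · exact G.point_ne_vertex ⟨hs.1.trans_le ht'.1, h1⟩ _ ht''
  · rw [cut_p, hi.cut_q]; exact one_ne_zero

lemma IsBridge.src_notMem_side_of_between [Finite V] {i j : E} (hi : G.IsBridge i) (hij : j ≠ i)
    {s t : ℝ} (hs : s ∈ Ico 0 (G.len i))
    (h : G.Between (G.q i) (G.point i s) (G.point j t)) : G.src j ∉ G.side i := by
  classical
  have := Fintype.ofFinite V
  intro hj
  refine not_between_of_cut_ne (i := i) (b := G.p i) ?_
    (JoinedIn.trans hj (G.joinedIn_deleteEdge hij t)) ?_ h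
  · rw [← point_zero]
    refine G.joinedIn_point fun t' ht' ht'' => ?_
    rw [uIcc_of_ge hs.1] at ht'
    rw [mem_singleton_iff] at ht''
    rcases ht'.1.eq_or_lt with h1 | h1
    · rw [← h1, point_zero, p_eq_q_iff] at ht''
      exact hi.tgt_notMem_side (ht'' ▸ G.src_mem_side i)
    · exact G.point_ne_vertex ⟨h1, ht'.2.trans_lt hs.2⟩ _ ht''
  · rw [cut_p, hi.cut_q]; exact zero_ne_one

/-- Let `A` be a set of vertices such that `i` is the only edge between `A` and its complement. Then
the end point of `i` in `A` is between the points of `i` and the points of the edges in `A`. -/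
lemma between_of_edge_cut [Finite V] [Finite E] {A : Set V} {a : V} {i j : E} (ha : a ∈ A)
    (hA : ∀ e ≠ i, (G.src e ∈ A ↔ G.tgt e ∈ A))
    (hi : G.src i = a ∧ G.tgt i ∉ A ∨ G.tgt i = a ∧ G.src i ∉ A) (hij : j ≠ i) (hj : G.src j ∈ A)
    {s t : ℝ} (hs : s ∈ Icc 0 (G.len i)) (ht : t ∈ Icc 0 (G.len j)) :
    G.Between (G.vertex a) (G.point i s) (G.point j t) := by
  classical
  have := Fintype.ofFinite V
  have := Fintype.ofFinite E
  -- A continuous `φ` is built that vanishes only at `a`, is nonnegative on `i` and nonpositive on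
  -- `j`; the intermediate value theorem along a path then forces a visit to `a`.
  let u : V → ℝ := fun v => if v = a then 0 else if v ∈ A then -1 else 1
  let T : Finset E := {e | e ≠ i ∧ G.src e ∈ A}
  -- Subtracting `hat` makes `φ` negative inside the edges of `A`, even for self-loops at `a`, where
  -- interpolation alone gives 0.
  let φ : G.Point → ℝ := fun x =>
    G.interpolate u x - ∑ e ∈ T, G.hat e (G.coord e x) (G.coord e x)
  have huA : ∀ v ∈ A, u v ≤ 0 := fun v hv => by simp only [u, hv]; split_ifs <;> norm_num
  have hia : ∀ t ∈ Icc 0 (G.len i), φ (G.point i t) =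
      (1 - t / G.len i) * u (G.src i) + t / G.len i * u (G.tgt i) := by
    intro t ht
    simp only [φ]
    rw [interpolate_point u ht, Finset.sum_eq_zero, sub_zero]
    intro e he
    rw [coord_point_of_ne G (Finset.mem_filter.1 he).2.1.symm, hat_zero_left _ _ le_rfl]
  have hself : ∀ (e : E), ∀ t ∈ Icc 0 (G.len e),
      G.hat e (G.coord e (G.point e t)) (G.coord e (G.point e t)) = t - t * t / G.len e := by
    intro e t ht
    rcases ht.2.eq_or_lt with h | h
    · have := (G.len_pos e).ne'
      rw [h, point_len, q, coord_vertex, hat_zero_left _ _ le_rfl]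
      field_simp; ring
    · rw [coord_point_self G ⟨ht.1, h⟩, hat_self]
  have hpt : ∀ e ≠ i, ∀ t ∈ Icc 0 (G.len e), φ (G.point e t) =
      (1 - t / G.len e) * u (G.src e) + t / G.len e * u (G.tgt e) -
        if G.src e ∈ A then t - t * t / G.len e else 0 := by
    intro e he t ht
    simp only [φ]
    have h0 : ∀ e' ≠ e, G.hat e' (G.coord e' (G.point e t)) (G.coord e' (G.point e t)) = 0 :=
      fun e' he' => by rw [coord_point_of_ne G he'.symm, hat_zero_left _ _ le_rfl]
    rw [interpolate_point u ht]
    congr 1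
    split_ifs with h
    · rw [Finset.sum_eq_single_of_mem e (by simp [T, he, h]) fun e' _ he' => h0 e' he', hself e t ht]
    · refine Finset.sum_eq_zero fun e' he' => h0 e' ?_
      rintro rfl
      exact h (Finset.mem_filter.1 he').2.2
  have hcont : Continuous φ := by
    refine G.continuous_of_point fun e => ?_
    by_cases he : e = i
    · subst he
      exact ContinuousOn.congr (by fun_prop) hia
    · refine ContinuousOn.congr ?_ (hpt e he)
      split_ifs <;> fun_prop
  have hua : u a = 0 := if_pos rfl
  have hub : ∀ v ∉ A, u v = 1 := fun v hv => by
    have hva : v ≠ a := fun h => hv (h ▸ ha)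
    simp [u, hv, hva]
  have hzero : ∀ x, φ x = 0 → x = G.vertex a := by
    intro x hx
    rcases G.exists_vertex_or_point x with ⟨v, rfl⟩ | ⟨e, t, ht, rfl⟩
    · by_contra hne
      have hva : v ≠ a := fun h => hne (h ▸ rfl)
      have : φ (G.vertex v) = u v := by
        simp only [φ, interpolate_vertex, coord_vertex, hat_self]
        simp
      rw [this] at hx
      simp only [u, hva, if_false] at hx
      split_ifs at hx <;> norm_num at hx
    · have hL := G.len_pos e
      have h0 : 0 < t / G.len e := div_pos ht.1 hL
      have h1 : 0 < 1 - t / G.len e := by rw [sub_pos, div_lt_one hL]; exact ht.2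
      exfalso
      by_cases he : e = i
      · subst he
        rw [hia t ⟨ht.1.le, ht.2.le⟩] at hx
        rcases hi with ⟨hi, hi'⟩ | ⟨hi, hi'⟩
        · rw [hi, hua, hub _ hi'] at hx
          linarith
        · rw [hi, hua, hub _ hi'] at hx
          linarith
      · rw [hpt e he t ⟨ht.1.le, ht.2.le⟩] at hx
        by_cases hA' : G.src e ∈ A
        · have h2 := huA _ hA'
          have h3 := huA _ ((hA e he).1 hA')
          rw [if_pos hA'] at hx
          have h4 : 0 < t - t * t / G.len e := by
            have : t - t * t / G.len e = t * (1 - t / G.len e) := by ring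
            rw [this]; exact mul_pos ht.1 h1
          have h5 := mul_nonneg h1.le (neg_nonneg.2 h2)
          have h6 := mul_nonneg h0.le (neg_nonneg.2 h3)
          linarith
        · rw [if_neg hA', hub _ hA', hub _ (mt (hA e he).2 hA')] at hx
          linarith
  have hx : 0 ≤ φ (G.point i s) := by
    have h0 : 0 ≤ s / G.len i := div_nonneg hs.1 (G.len_pos i).le
    have h1 : 0 ≤ 1 - s / G.len i := by
      rw [sub_nonneg, div_le_one (G.len_pos i)]; exact hs.2
    rw [hia s hs]
    rcases hi with ⟨hi, hi'⟩ | ⟨hi, hi'⟩ <;> rw [hi, hua, hub _ hi'] <;> linarith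
  have hy : φ (G.point j t) ≤ 0 := by
    have h0 : 0 ≤ t / G.len j := div_nonneg ht.1 (G.len_pos j).le
    have h1 : 0 ≤ 1 - t / G.len j := by
      rw [sub_nonneg, div_le_one (G.len_pos j)]; exact ht.2
    rw [hpt j hij t ht, if_pos hj]
    have h4 : 0 ≤ t - t * t / G.len j := by
      have : t - t * t / G.len j = t * (1 - t / G.len j) := by ring
      rw [this]; exact mul_nonneg ht.1 h1
    have h5 := mul_nonneg h1 (neg_nonneg.2 (huA _ hj))
    have h6 := mul_nonneg h0 (neg_nonneg.2 (huA _ ((hA j hij).1 hj)))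
    linarith
  intro γ
  obtain ⟨c, hc, hc0⟩ := (isPreconnected_range γ.continuous).intermediate_value
    (⟨1, γ.target⟩ : G.point j t ∈ range γ) ⟨0, γ.source⟩ hcont.continuousOn ⟨hy, hx⟩
  rwa [← hzero c hc0]

lemma IsBridge.between_p [Finite V] [Finite E] {i j : E} (hi : G.IsBridge i) (hij : j ≠ i)
    (hj : G.src j ∈ G.side i) {s t : ℝ} (hs : s ∈ Icc 0 (G.len i)) (ht : t ∈ Icc 0 (G.len j)) :
    G.Between (G.p i) (G.point i s) (G.point j t) :=
  between_of_edge_cut (A := G.side i) (G.src_mem_side i) (fun _ he => G.src_mem_side_iff he)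
    (Or.inl ⟨rfl, hi.tgt_notMem_side⟩) hij hj hs ht

lemma IsBridge.between_q [Finite V] [Finite E] {i j : E} (hi : G.IsBridge i) (hij : j ≠ i)
    (hj : G.src j ∉ G.side i) {s t : ℝ} (hs : s ∈ Icc 0 (G.len i)) (ht : t ∈ Icc 0 (G.len j)) :
    G.Between (G.q i) (G.point i s) (G.point j t) :=
  between_of_edge_cut (A := (G.side i)ᶜ) hi.tgt_notMem_side
    (fun _ he => not_congr (G.src_mem_side_iff he))
    (Or.inr ⟨rfl, not_not.2 (G.src_mem_side i)⟩) hij hj hs ht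

/-! ### Resistance across a bridge -/

section resistance

variable [DecidableEq V] [DecidableEq E] [Fintype V] [Fintype E] [Nonempty V]

/-- The bridge is the only edge with a voltage drop, and the drop `len i` drives exactly a unit
current. -/
lemma IsBridge.laplacian_side {i : E} (hi : G.IsBridge i) (c : ℝ) (v : V)
    [DecidablePred (· ∈ G.side i)] :
    G.laplacian (fun v => G.len i * ((if v ∈ G.side i then 1 else 0) - c)) v =
      G.incidence i v := by
  rw [laplacian, Finset.sum_eq_single i]
  · have := (G.len_pos i).ne'
    rw [if_pos (G.src_mem_side i), if_neg hi.tgt_notMem_side]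
    field_simp
    ring
  · intro e _ he
    simp only [G.src_mem_side_iff he]
    ring
  · simp

/-- The current that a unit current from `p i` to `q i` induces is concentrated on the bridge. -/
lemma IsBridge.exists_kernel_sub {i : E} (hi : G.IsBridge i) :
    ∃ c : ℝ, ∀ y, G.kernel (G.p i) y - G.kernel (G.q i) y = G.len i * (G.cut i y - c) := by
  classical
  have hV : (Fintype.card V : ℝ) ≠ 0 := by simp
  let χ : V → ℝ := fun v => if v ∈ G.side i then 1 else 0
  refine ⟨(∑ v, χ v) / Fintype.card V, fun y => ?_⟩
  -- Subtracting the mean gives total 0, the normalization that `potential` requires.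
  let w : V → ℝ := fun v => G.len i * (χ v - (∑ v, χ v) / Fintype.card V)
  have hw : G.potential (G.incidence i) = w := by
    rw [← G.potential_laplacianAddOnes_mulVec w]
    congr 1
    funext v
    have hsum : ∑ v, w v = 0 := by
      simp only [w, ← Finset.mul_sum, Finset.sum_sub_distrib, Finset.sum_const, Finset.card_univ,
        nsmul_eq_mul]
      field_simp
      ring
    rw [laplacianAddOnes_mulVec, hsum, add_zero]
    exact (hi.laplacian_side _ v).symm
  have h := G.dotProduct_potential_comm (G.incidence i) (G.weight y)
  rw [hw, incidence, sub_dotProduct, single_one_dotProduct, single_one_dotProduct] at h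
  rw [p, q, kernel_vertex, kernel_vertex, h]
  simp only [dotProduct, w, mul_sub, Finset.sum_sub_distrib, ← Finset.sum_mul, sum_weight, cut,
    interpolate, one_mul]
  rw [Finset.mul_sum]
  congr 1
  exact Finset.sum_congr rfl fun v _ => by simp only [χ]; ring

lemma coord_eq_zero_of_mem_deleteEdge {i : E} {y : G.Point} (hy : y ∈ G.deleteEdge i) :
    G.coord i y = 0 := by
  rcases G.vertex_or_point_of_mem_deleteEdge hy with ⟨v, rfl⟩ | ⟨e, he, t, -, rfl⟩
  · rfl
  · exact coord_point_of_ne G he t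

/-- Evaluating `exists_kernel_sub` at `y`, `p i` and `q i` expresses all the kernel values at `q i`
through those at `p i`; the unknown constant cancels. -/
lemma IsBridge.resistance_of_cut_eq_one {i : E} (hi : G.IsBridge i) {s : ℝ}
    (hs : s ∈ Icc 0 (G.len i)) {y : G.Point} (hy : y ∈ G.deleteEdge i) (hc : G.cut i y = 1) :
    G.resistance (G.point i s) y = s + G.resistance (G.p i) y := by
  obtain ⟨c, h⟩ := hi.exists_kernel_sub
  have hL := (G.len_pos i).ne'
  have h1 := h y
  have h2 := h (G.p i)
  have h3 := h (G.q i)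
  rw [hc] at h1
  rw [cut_p] at h2
  rw [hi.cut_q] at h3
  have h0 : G.hat i s 0 = 0 := by rw [hat_comm, hat_zero_left _ _ hs.1]
  rw [resistance_eq, resistance_eq, kernel_point_self G hs, kernel_point G hs,
    coord_eq_zero_of_mem_deleteEdge hy, h0]
  rw [kernel_comm G (G.q i) (G.p i)] at h2
  have e1 : G.kernel (G.q i) y = G.kernel (G.p i) y - G.len i * (1 - c) := by linarith
  have e2 : G.kernel (G.p i) (G.q i) = G.kernel (G.p i) (G.p i) - G.len i * (1 - c) := by linarith
  have e3 : G.kernel (G.q i) (G.q i) =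
      G.kernel (G.p i) (G.p i) - G.len i * (1 - c) + G.len i * c := by linarith
  rw [e1, e2, e3]
  field_simp
  ring

lemma IsBridge.resistance_of_cut_eq_zero {i : E} (hi : G.IsBridge i) {s : ℝ}
    (hs : s ∈ Icc 0 (G.len i)) {y : G.Point} (hy : y ∈ G.deleteEdge i) (hc : G.cut i y = 0) :
    G.resistance (G.point i s) y = G.len i - s + G.resistance (G.q i) y := by
  obtain ⟨c, h⟩ := hi.exists_kernel_sub
  have hL := (G.len_pos i).ne'
  have h1 := h y
  have h2 := h (G.p i)
  have h3 := h (G.q i)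
  rw [hc] at h1
  rw [cut_p] at h2
  rw [hi.cut_q] at h3
  have h0 : G.hat i s 0 = 0 := by rw [hat_comm, hat_zero_left _ _ hs.1]
  rw [resistance_eq, resistance_eq, kernel_point_self G hs, kernel_point G hs,
    coord_eq_zero_of_mem_deleteEdge hy, h0]
  rw [kernel_comm G (G.q i) (G.p i)] at h2
  have e1 : G.kernel (G.p i) y = G.kernel (G.q i) y - G.len i * c := by linarith
  have e2 : G.kernel (G.p i) (G.q i) = G.kernel (G.q i) (G.q i) - G.len i * c := by linarith
  have e3 : G.kernel (G.p i) (G.p i) =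
      G.kernel (G.q i) (G.q i) - G.len i * c + G.len i * (1 - c) := by linarith
  rw [e1, e2, e3]
  field_simp
  ring

lemma IsBridge.resistance_same {i : E} (hi : G.IsBridge i) {s t : ℝ}
    (hs : s ∈ Icc 0 (G.len i)) (ht : t ∈ Icc 0 (G.len i)) :
    G.resistance (G.point i s) (G.point i t) = |s - t| := by
  wlog hst : s ≤ t generalizing s t
  · rw [resistance_comm, abs_sub_comm]
    exact this ht hs (le_of_not_ge hst)
  obtain ⟨c, h⟩ := hi.exists_kernel_sub
  have hL := (G.len_pos i).ne'
  have h2 := h (G.p i)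
  have h3 := h (G.q i)
  rw [cut_p] at h2
  rw [hi.cut_q] at h3
  rw [kernel_comm G (G.q i) (G.p i)] at h2
  have h0 : G.hat i t 0 = 0 := by rw [hat_comm, hat_zero_left _ _ ht.1]
  have hh : G.hat i s (G.coord i (G.point i t)) = s - s * t / G.len i := by
    rcases ht.2.eq_or_lt with h | h
    · rw [h, point_len, q, coord_vertex, hat_comm, hat_zero_left _ _ hs.1]
      field_simp; ring
    · rw [coord_point_self G ⟨ht.1, h⟩, hat, min_eq_left hst]
  have e2 : G.kernel (G.p i) (G.q i) = G.kernel (G.p i) (G.p i) - G.len i * (1 - c) := by linarith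
  have e3 : G.kernel (G.q i) (G.q i) =
      G.kernel (G.p i) (G.p i) - G.len i * (1 - c) + G.len i * c := by linarith
  have hp : G.coord i (G.p i) = 0 := rfl
  have hq : G.coord i (G.q i) = 0 := rfl
  rw [resistance_eq, kernel_point_self G hs, kernel_point_self G ht, kernel_point G hs, hh,
    kernel_comm G (G.p i) (G.point i t), kernel_comm G (G.q i) (G.point i t), kernel_point G ht,
    kernel_point G ht, hp, hq, h0, kernel_comm G (G.q i) (G.p i), e2, e3, abs_of_nonpos (by linarith)]
  field_simp
  ring

/-- Betweenness at one parameter `t` places the whole edge `j` on the side of `p i`, so the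
conclusion holds at any other parameter `t'`. If `s = 0` it is trivial. -/
lemma IsBridge.resistance_of_between_p {i j : E} (hi : G.IsBridge i) (hij : j ≠ i) {s t : ℝ}
    (hs : s ∈ Icc 0 (G.len i)) (h : G.Between (G.p i) (G.point i s) (G.point j t)) {t' : ℝ}
    (ht' : t' ∈ Icc 0 (G.len j)) :
    G.resistance (G.point i s) (G.point j t') = s + G.resistance (G.p i) (G.point j t') := by
  rcases hs.1.eq_or_lt with h0 | h0
  · rw [← h0, point_zero, zero_add]
  · exact hi.resistance_of_cut_eq_one hs (G.point_mem_deleteEdge hij t')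
      (cut_point_of_mem hij ht' (hi.src_mem_side_of_between hij ⟨h0, hs.2⟩ h))

lemma IsBridge.resistance_of_between_q {i j : E} (hi : G.IsBridge i) (hij : j ≠ i) {s t : ℝ}
    (hs : s ∈ Icc 0 (G.len i)) (h : G.Between (G.q i) (G.point i s) (G.point j t)) {t' : ℝ}
    (ht' : t' ∈ Icc 0 (G.len j)) :
    G.resistance (G.point i s) (G.point j t') =
      G.len i - s + G.resistance (G.q i) (G.point j t') := by
  rcases hs.2.eq_or_lt with h0 | h0
  · rw [h0, point_len]; ring
  · exact hi.resistance_of_cut_eq_zero hs (G.point_mem_deleteEdge hij t')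
      (cut_point_of_notMem hij ht' (hi.src_notMem_side_of_between hij ⟨hs.1, h0⟩ h))

end resistance

end

end MetrizedGraph

namespace MetrizedGraph

open MeasureTheory Set

set_option linter.unusedSectionVars false

noncomputable section

variable {V E : Type*} {G : MetrizedGraph V E}

/-! ### The Arakelov-Green function on bridges -/

section green

variable [DecidableEq V] [DecidableEq E] [Fintype V] [Fintype E] [Nonempty V]

lemma greenCan_comm (x y : G.Point) : G.greenCan x y = G.greenCan y x := by
  rw [greenCan_eq, greenCan_eq, resistance_comm]

lemma IsBridge.exists_between {i j : E} (hi : G.IsBridge i) (hij : j ≠ i) {x y : ℝ}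
    (hx : x ∈ Icc 0 (G.len i)) (hy : y ∈ Icc 0 (G.len j)) :
    G.Between (G.p i) (G.point i x) (G.point j y) ∨
      G.Between (G.q i) (G.point i x) (G.point j y) := by
  by_cases h : G.src j ∈ G.side i
  · exact Or.inl (hi.between_p hij h hx hy)
  · exact Or.inr (hi.between_q hij h hx hy)

lemma IsBridge.greenCan_of_onSide_p {i j : E} (hi : G.IsBridge i) (hij : j ≠ i) {x y : ℝ}
    (hx : x ∈ Icc 0 (G.len i)) (hy : y ∈ Icc 0 (G.len j))
    (h : G.OnSide i (G.p i) (G.point j y)) :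
    G.greenCan (G.point i x) (G.point j y) =
      G.tau + y ^ 2 * ((G.len j - G.resistance (G.p j) (G.q j)) / (2 * G.len j ^ 2))
        - y * ((G.len j - G.resistance (G.p j) (G.q j) + G.resistance (G.p i) (G.q j)
            - G.resistance (G.p i) (G.p j)) / (2 * G.len j))
        - (1 / 2) * (x + G.resistance (G.p i) (G.p j)) := by
  have hL := (G.len_pos j).ne'
  have hc : G.cut i (G.point j y) = 1 := (cut_eq_of_onSide h).trans (cut_p i)
  rw [greenCan_eq, hi.resistance_of_cut_eq_one hx (G.point_mem_deleteEdge hij y) hc]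
  have h := G.resistance_vertex_point (G.src i) hy
  rw [← p] at h
  rw [h]
  field_simp
  ring

lemma IsBridge.greenCan_of_onSide_q {i j : E} (hi : G.IsBridge i) (hij : j ≠ i) {x y : ℝ}
    (hx : x ∈ Icc 0 (G.len i)) (hy : y ∈ Icc 0 (G.len j))
    (h : G.OnSide i (G.q i) (G.point j y)) :
    G.greenCan (G.point i x) (G.point j y) =
      G.tau + y ^ 2 * ((G.len j - G.resistance (G.p j) (G.q j)) / (2 * G.len j ^ 2))
        - y * ((G.len j - G.resistance (G.p j) (G.q j) + G.resistance (G.q i) (G.q j)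
            - G.resistance (G.q i) (G.p j)) / (2 * G.len j))
        - (1 / 2) * (G.len i - x + G.resistance (G.q i) (G.p j)) := by
  have hL := (G.len_pos j).ne'
  have hc : G.cut i (G.point j y) = 0 := (cut_eq_of_onSide h).trans hi.cut_q
  rw [greenCan_eq, hi.resistance_of_cut_eq_zero hx (G.point_mem_deleteEdge hij y) hc]
  have h := G.resistance_vertex_point (G.tgt i) hy
  rw [← q] at h
  rw [h]
  field_simp
  ring

end green

end

end MetrizedGraph

/-! ### The theorem -/

theorem theorem4p4 {V E : Type*} [Finite V] [Nonempty V] [Fintype E] (G : MetrizedGraph V E)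
    (i j : E) (x y : ℝ) (hx : x ∈ Set.Icc 0 (G.len i)) (hy : y ∈ Set.Icc 0 (G.len j)) :
    -- `x` and `y` are on the same bridge
    (i = j → G.IsBridge i →
      G.greenCan (G.point i x) (G.point j y) = G.tau - (1 / 2) * |x - y|) ∧
    -- `e_i` and `e_j` are distinct bridges: four cases, one of which always occurs
    (i ≠ j → G.IsBridge i → G.IsBridge j →
      ((G.Between (G.p i) (G.point i x) (G.point j y) ∧
            G.Between (G.p j) (G.point i x) (G.point j y)) ∨
        (G.Between (G.p i) (G.point i x) (G.point j y) ∧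
            G.Between (G.q j) (G.point i x) (G.point j y)) ∨
        (G.Between (G.p j) (G.point i x) (G.point j y) ∧
            G.Between (G.q i) (G.point i x) (G.point j y)) ∨
        (G.Between (G.q i) (G.point i x) (G.point j y) ∧
            G.Between (G.q j) (G.point i x) (G.point j y))) ∧
      (G.Between (G.p i) (G.point i x) (G.point j y) →
        G.Between (G.p j) (G.point i x) (G.point j y) →
        G.greenCan (G.point i x) (G.point j y) =
          G.tau - (1 / 2) * (x + y + G.resistance (G.p i) (G.p j))) ∧
      (G.Between (G.p i) (G.point i x) (G.point j y) →
        G.Between (G.q j) (G.point i x) (G.point j y) →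
        G.greenCan (G.point i x) (G.point j y) =
          G.tau - (1 / 2) * (x + G.len j - y + G.resistance (G.p i) (G.q j))) ∧
      (G.Between (G.p j) (G.point i x) (G.point j y) →
        G.Between (G.q i) (G.point i x) (G.point j y) →
        G.greenCan (G.point i x) (G.point j y) =
          G.tau - (1 / 2) * (G.len i - x + y + G.resistance (G.p j) (G.q i))) ∧
      (G.Between (G.q i) (G.point i x) (G.point j y) →
        G.Between (G.q j) (G.point i x) (G.point j y) →
        G.greenCan (G.point i x) (G.point j y) =
          G.tau - (1 / 2) * (G.len i - x + G.len j - y + G.resistance (G.q i) (G.q j)))) ∧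
    -- only `e_i` is a bridge: two cases, one of which always occurs
    (G.IsBridge i → ¬ G.IsBridge j →
      (G.OnSide i (G.p i) (G.point j y) ∨ G.OnSide i (G.q i) (G.point j y)) ∧
      (G.OnSide i (G.p i) (G.point j y) →
        G.greenCan (G.point i x) (G.point j y) =
          G.tau + y ^ 2 * ((G.len j - G.resistance (G.p j) (G.q j)) / (2 * G.len j ^ 2))
            - y * ((G.len j - G.resistance (G.p j) (G.q j) + G.resistance (G.p i) (G.q j)
                - G.resistance (G.p i) (G.p j)) / (2 * G.len j))
            - (1 / 2) * (x + G.resistance (G.p i) (G.p j))) ∧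
      (G.OnSide i (G.q i) (G.point j y) →
        G.greenCan (G.point i x) (G.point j y) =
          G.tau + y ^ 2 * ((G.len j - G.resistance (G.p j) (G.q j)) / (2 * G.len j ^ 2))
            - y * ((G.len j - G.resistance (G.p j) (G.q j) + G.resistance (G.q i) (G.q j)
                - G.resistance (G.q i) (G.p j)) / (2 * G.len j))
            - (1 / 2) * (G.len i - x + G.resistance (G.q i) (G.p j)))) ∧
    -- only `e_j` is a bridge: the same with the roles of `(e_i, x)` and `(e_j, y)` exchanged
    (¬ G.IsBridge i → G.IsBridge j →
      (G.OnSide j (G.p j) (G.point i x) ∨ G.OnSide j (G.q j) (G.point i x)) ∧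
      (G.OnSide j (G.p j) (G.point i x) →
        G.greenCan (G.point i x) (G.point j y) =
          G.tau + x ^ 2 * ((G.len i - G.resistance (G.p i) (G.q i)) / (2 * G.len i ^ 2))
            - x * ((G.len i - G.resistance (G.p i) (G.q i) + G.resistance (G.p j) (G.q i)
                - G.resistance (G.p j) (G.p i)) / (2 * G.len i))
            - (1 / 2) * (y + G.resistance (G.p j) (G.p i))) ∧
      (G.OnSide j (G.q j) (G.point i x) →
        G.greenCan (G.point i x) (G.point j y) =
          G.tau + x ^ 2 * ((G.len i - G.resistance (G.p i) (G.q i)) / (2 * G.len i ^ 2))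
            - x * ((G.len i - G.resistance (G.p i) (G.q i) + G.resistance (G.q j) (G.q i)
                - G.resistance (G.q j) (G.p i)) / (2 * G.len i))
            - (1 / 2) * (G.len j - y + G.resistance (G.q j) (G.p i)))) := by
  classical
  have := Fintype.ofFinite V
  have hLi := (G.len_pos i).le
  have hLj := (G.len_pos j).le
  refine ⟨?_, fun hij hi hj => ?_, fun hi hj => ?_, fun hi hj => ?_⟩
  · rintro rfl hi
    rw [G.greenCan_eq, hi.resistance_same hx hy]
  · have hpi : G.point i 0 = G.p i := G.point_zero i
    have hqi : G.point i (G.len i) = G.q i := G.point_len i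
    refine ⟨?_, fun h₁ h₂ => ?_, fun h₁ h₂ => ?_, fun h₁ h₂ => ?_, fun h₁ h₂ => ?_⟩
    · rcases hi.exists_between hij.symm hx hy with h₁ | h₁ <;>
        rcases hj.exists_between hij hy hx with h₂ | h₂
      · exact Or.inl ⟨h₁, h₂.symm⟩
      · exact Or.inr (Or.inl ⟨h₁, h₂.symm⟩)
      · exact Or.inr (Or.inr (Or.inl ⟨h₂.symm, h₁⟩))
      · exact Or.inr (Or.inr (Or.inr ⟨h₁, h₂.symm⟩))
    -- Betweenness is known for the point `x` of `i` but is applied at the end point `p i`, which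
    -- remains after the part of `i` has been split off.
    · have h := hj.resistance_of_between_p hij hy h₂.symm ⟨le_rfl, hLi⟩
      rw [hpi] at h
      rw [G.greenCan_eq, hi.resistance_of_between_p hij.symm hx h₁ hy,
        G.resistance_comm (G.p i) (G.point j y), h, G.resistance_comm (G.p j) (G.p i)]
      ring
    · have h := hj.resistance_of_between_q hij hy h₂.symm ⟨le_rfl, hLi⟩
      rw [hpi] at h
      rw [G.greenCan_eq, hi.resistance_of_between_p hij.symm hx h₁ hy,
        G.resistance_comm (G.p i) (G.point j y), h, G.resistance_comm (G.q j) (G.p i)]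
      ring
    · have h := hj.resistance_of_between_p hij hy h₁.symm ⟨hLi, le_rfl⟩
      rw [hqi] at h
      rw [G.greenCan_eq, hi.resistance_of_between_q hij.symm hx h₂ hy,
        G.resistance_comm (G.q i) (G.point j y), h]
      ring
    · have h := hj.resistance_of_between_q hij hy h₂.symm ⟨hLi, le_rfl⟩
      rw [hqi] at h
      rw [G.greenCan_eq, hi.resistance_of_between_q hij.symm hx h₁ hy,
        G.resistance_comm (G.q i) (G.point j y), h, G.resistance_comm (G.q j) (G.q i)]
      ring
  · have hij : j ≠ i := fun h => hj (h ▸ hi)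
    exact ⟨G.onSide_p_or_q hij y, hi.greenCan_of_onSide_p hij hx hy,
      hi.greenCan_of_onSide_q hij hx hy⟩
  · have hij : i ≠ j := fun h => hi (h ▸ hj)
    refine ⟨G.onSide_p_or_q hij x, fun h => ?_, fun h => ?_⟩
    · rw [MetrizedGraph.greenCan_comm]
      exact hj.greenCan_of_onSide_p hij hy hx h
    · rw [MetrizedGraph.greenCan_comm]
      exact hj.greenCan_of_onSide_q hij hy hx h
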